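/- Let $(E,d)$ be a complete separable metric space with Borel $\sigma$-field $\mathcal B(E)$, let $C_b(E)$ be the space of bounded continuous real functions on $E$, and let $A$ be an operator with domain $\mathcal D(A)\subseteq C_b(E)$ whose values $Af$ are real-valued Borel functions on $E$. Let $\Phi:E\to[0,\infty)$ be Borel measurable. A *solution to the martingale problem for $(A,\lambda)$*, where $\lambda$ is a probability measure on $E$, is an $E$-valued process $X=(X_t)_{t\ge0}$ on a probability space $(\Omega,\mathcal F,\mathbb P)$ such that (i) $X$ is measurable (i.e. $(t,\omega)\mapsto X_t(\omega)$ is jointly measurable) and $X_0$ has law $\lambda$; (ii) $\mathbb E\big[\int_0^T\Phi(X_s)\,ds\big]<\infty$ for all $T<\infty$; (iii) for every $f\in\mathcal D(A)$, the process $f(X_t)-\int_0^tAf(X_s)\,ds$ is a martingale with respect to the filtration ${}^*\mathcal F^X_t=\sigma\big(X_u,\ \int_0^uh(X_s)\,ds:\ u\le t,\ h\in C_b(E)\big)$. The process $X$ is *continuous in probability* if $X_s\to X_t$ in probability as $s\to t$, for every $t\ge0$. Assume: - **(A1)** for every $f\in\mathcal D(A)$ there is a constant $C_f$ with $|Af(x)|\le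 C_f\,\Phi(x)$ for all $x\in E$; - **(A2)** there is a countable set $S\subseteq\mathcal D(A)$ such that $\{(f,\Phi^{-1}Af): f\in\mathcal D(A)\}$ is contained in the bp-closure of $\{(f,\Phi^{-1}Af): f\in S\}$, i.e. in the smallest set of pairs of bounded Borel functions that contains the latter set and is closed under bounded pointwise convergence of sequences (with $\Phi^{-1}Af:=0$ where $\Phi=0$); - **(A3)** for every $x\in E$ there is a solution to the martingale problem for $(A,\delta_x)$ that is continuous in probability, and any two such solutions (possibly on different probability spaces) have the same finite-dimensional distributions. For every $x\in E$ let $X^x$ be a solution to the martingale problem for $(A,\delta_x)$ that is continuous in probability, on a probability space with measure $\mathbb P_x$. Then: 1. For all $t\ge0$ and $B\in\mathcal B(E)$, the map $x\mapsto p_t(x,B):=\mathbb P_x(X^x_t\in B)$ is Borel measurable on $E$. 2. For every $x\in E$ and every $m$, the finite-dimensional distributions $\mu^m_x(t_1,\dots,t_m):=\mathcal L(X^x_{t_1},\dots,X^x_{t_m})$ depend continuously on $(t_1,\dots,t_m)\in[0,\infty)^m$, so that $\mu_x=(\mu^m_x)_m$ is an element of $\prod_m C([0,\infty)^m,\mathcal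 P(E^m))$, where $\mathcal P(E^m)$ has the topology of weak convergence, each space of continuous maps has the topology of uniform convergence on compact sets, and the product has the product topology. The map $x\mapsto\mu_x$ is Borel measurable, and so is $x\mapsto\mu^m_x(t_1,\dots,t_m)\in\mathcal P(E^m)$ for all $m$ and all $t_1,\dots,t_m\ge0$. -/

import Mathlib

open MeasureTheory ProbabilityTheory Filter Topology
open scoped NNReal ENNReal BoundedContinuousFunction

universe u

namespace MartingaleProblem

section BP

variable {E : Type u}

/-- A set of pairs of real functions is closed under bounded pointwise convergence of sequences:
it contains the pointwise limit of each of its uniformly bounded, pointwise convergent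
sequences. -/
def IsBPClosed (S : Set ((E → ℝ) × (E → ℝ))) : Prop :=
  ∀ (w : ℕ → (E → ℝ) × (E → ℝ)) (p : (E → ℝ) × (E → ℝ)),
    (∀ n, w n ∈ S) →
    (∃ K : ℝ, ∀ n x, |(w n).1 x| ≤ K ∧ |(w n).2 x| ≤ K) →
    (∀ x, Tendsto (fun n => (w n).1 x) atTop (𝓝 (p.1 x)) ∧
      Tendsto (fun n => (w n).2 x) atTop (𝓝 (p.2 x))) →
    p ∈ S

/-- The bp-closure: the smallest set containing `C` that is closed under bounded pointwise
convergence of sequences. (When `C` consists of pairs of bounded Borel functions, so does its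
bp-closure, because the set of all such pairs is itself closed under bounded pointwise
convergence.) -/
def bpClosure (C : Set ((E → ℝ) × (E → ℝ))) : Set ((E → ℝ) × (E → ℝ)) :=
  ⋂₀ {S | C ⊆ S ∧ IsBPClosed S}

end BP

section Solutions

variable {E : Type u} [MeasurableSpace E]
variable {Ω : Type u} [mΩ : MeasurableSpace Ω]

/-- `X` is a measurable process: `(t, ω) ↦ X t ω` is jointly measurable. -/
def IsMeasurableProcess (X : ℝ≥0 → Ω → E) : Prop :=
  Measurable fun p : ℝ≥0 × Ω => X p.1 p.2

/-- The time integral `∫₀ᵗ g (X_s) ds` along the path `s ↦ X s ω`. -/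
noncomputable def pathIntegral (g : E → ℝ) (X : ℝ≥0 → Ω → E) (t : ℝ≥0) (ω : Ω) : ℝ :=
  ∫ s in (0 : ℝ)..(t : ℝ), g (X s.toNNReal ω)

theorem measurable_pathIntegral {g : E → ℝ} (hg : Measurable g) {X : ℝ≥0 → Ω → E}
    (hX : IsMeasurableProcess X) (t : ℝ≥0) : Measurable (pathIntegral g X t) := by
  have h : Measurable fun p : Ω × ℝ => g (X p.2.toNNReal p.1) :=
    hg.comp (hX.comp ((measurable_real_toNNReal.comp measurable_snd).prodMk measurable_fst))
  have h' := h.stronglyMeasurable.integral_prod_right'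
    (ν := (volume : Measure ℝ).restrict (Set.Ioc 0 (t : ℝ)))
  have e : pathIntegral g X t
      = fun ω => ∫ s in Set.Ioc (0 : ℝ) (t : ℝ), g (X s.toNNReal ω) := by
    funext ω
    exact intervalIntegral.integral_of_le t.2
  rw [e]
  exact h'.measurable

variable [MetricSpace E] [BorelSpace E]

/-- The filtration of the process,
`t ↦ σ(X_u, ∫₀ᵘ h(X_s) ds : u ≤ t, h ∈ C_b(E))`. -/
noncomputable def starFiltration (X : ℝ≥0 → Ω → E) (hX : IsMeasurableProcess X) :
    Filtration ℝ≥0 mΩ where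
  seq t := ⨆ (v : ℝ≥0) (_ : v ≤ t), MeasurableSpace.comap (X v) inferInstance ⊔
    ⨆ h : E →ᵇ ℝ, MeasurableSpace.comap (pathIntegral (fun x => h x) X v) inferInstance
  mono' := fun _ _ hst => iSup₂_mono' fun v hv => ⟨v, hv.trans hst, le_rfl⟩
  le' := fun _ => iSup₂_le fun v _ => sup_le
    (hX.comp (measurable_const.prodMk measurable_id)).comap_le
    (iSup_le fun h => (measurable_pathIntegral h.continuous.measurable hX v).comap_le)

/-- `X`, defined on the probability space `(Ω, P)`, is a solution of the martingale problem for
`(A, lam)`; here `A` has domain `D ⊆ C_b(E)` and `Φ` is the dominating function. -/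
structure IsSolution (D : Set (E →ᵇ ℝ)) (A : D → E → ℝ) (Φ : E → ℝ≥0) (lam : Measure E)
    (P : Measure Ω) (X : ℝ≥0 → Ω → E) : Prop where
  measurable : IsMeasurableProcess X
  initial : P.map (X 0) = lam
  integrable : ∀ T : ℝ≥0,
    ∫⁻ ω, ∫⁻ s in Set.Ioc (0 : ℝ) (T : ℝ), (Φ (X s.toNNReal ω) : ℝ≥0∞) ∂volume ∂P < ∞
  martingale : ∀ f : D, Martingale
    (fun t ω => (f : E →ᵇ ℝ) (X t ω) - pathIntegral (A f) X t ω) (starFiltration X measurable) P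

/-- `X` is continuous in probability: `X_s → X_t` in probability as `s → t`, for every `t ≥ 0`. -/
def IsContinuousInProbability (P : Measure Ω) (X : ℝ≥0 → Ω → E) : Prop :=
  ∀ t : ℝ≥0, TendstoInMeasure P X (𝓝 t) (X t)

/-- The finite-dimensional distribution: the law of `(X_{t_1}, …, X_{t_m})` under `P`. -/
noncomputable def fdd (P : Measure Ω) (X : ℝ≥0 → Ω → E) {m : ℕ} (t : Fin m → ℝ≥0) :
    Measure (Fin m → E) :=
  P.map fun ω i => X (t i) ω

end Solutions

section WellPosed

variable {E : Type u} [MetricSpace E] [MeasurableSpace E] [BorelSpace E]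

/-- The domination assumption: `|Af(x)| ≤ C_f Φ(x)` for all `x` and all `f` in the domain. -/
def IsDominated (D : Set (E →ᵇ ℝ)) (A : D → E → ℝ) (Φ : E → ℝ≥0) : Prop :=
  ∀ f : D, ∃ C : ℝ, ∀ x, |A f x| ≤ C * Φ x

/-- The pair `(f, Φ⁻¹ Af)`. Where `Φ` vanishes, `Af` vanishes too (under domination) and the
second component is `0`. -/
noncomputable def scaledPair (D : Set (E →ᵇ ℝ)) (A : D → E → ℝ) (Φ : E → ℝ≥0) (f : D) :
    (E → ℝ) × (E → ℝ) :=
  (fun x => (f : E →ᵇ ℝ) x, fun x => (Φ x : ℝ)⁻¹ * A f x)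

/-- The separability assumption: for some countable `S ⊆ D`, every pair `(f, Φ⁻¹ Af)`, `f ∈ D`,
is in the bp-closure of the pairs with `f ∈ S`. -/
def IsBPSeparable (D : Set (E →ᵇ ℝ)) (A : D → E → ℝ) (Φ : E → ℝ≥0) : Prop :=
  ∃ S : Set D, S.Countable ∧
    Set.range (scaledPair D A Φ) ⊆ bpClosure (scaledPair D A Φ '' S)

/-- For every `x`, the martingale problem for `(A, δ_x)` is well-posed in the class of solutions
that are continuous in probability: there is such a solution, and any two such solutions, possibly
on different probability spaces, have the same finite-dimensional distributions. -/
def IsWellPosed (D : Set (E →ᵇ ℝ)) (A : D → E → ℝ) (Φ : E → ℝ≥0) : Prop :=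
  ∀ x : E,
    (∃ (Ω : Type u) (_ : MeasurableSpace Ω) (P : Measure Ω) (_ : IsProbabilityMeasure P)
      (X : ℝ≥0 → Ω → E),
      IsSolution D A Φ (Measure.dirac x) P X ∧ IsContinuousInProbability P X) ∧
    ∀ (Ω Ω' : Type u) [MeasurableSpace Ω] [MeasurableSpace Ω']
      (P : Measure Ω) (P' : Measure Ω') [IsProbabilityMeasure P] [IsProbabilityMeasure P']
      (X : ℝ≥0 → Ω → E) (Y : ℝ≥0 → Ω' → E),
      IsSolution D A Φ (Measure.dirac x) P X → IsContinuousInProbability P X →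
      IsSolution D A Φ (Measure.dirac x) P' Y → IsContinuousInProbability P' Y →
      ∀ (m : ℕ) (t : Fin m → ℝ≥0), fdd P X t = fdd P' Y t

end WellPosed

/-- The space in which families of finite-dimensional distributions of processes that are
continuous in probability live: the product over `m` of `C([0,∞)^m, 𝒫(E^m))`. Here `𝒫(E^m)` has
the topology of weak convergence, the space of continuous maps the compact-open topology (uniform
convergence on compact sets), and the product the product topology. -/
abbrev FddSpace (E : Type u) [MetricSpace E] [SecondCountableTopology E] [MeasurableSpace E]
    [BorelSpace E] : Type u :=
  ∀ m : ℕ, C(Fin m → ℝ≥0, ProbabilityMeasure (Fin m → E))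

end MartingaleProblem

/-! The solutions started from a point are encoded by points of a standard Borel space. The relation
"c encodes a solution started at x" turns out to be Borel, and Suslin's theorem then gives
measurability in x.

A code is a pair (Q, n): the law Q of the path at nonnegative rational times, and a sequence n that
quantifies continuity in probability. Along the grids prescribed by n a rational path converges
almost surely at each real time, and the limits `extendPath` form a measurable process. The laws Q
are parametrized by ℚ → ℝ through distribution functions
(`exists_kernel_eq_of_isProbabilityMeasure`).

Being a good code amounts to countably many Borel conditions (`measurableSet_isGoodCode`): the
modulus, the cost bound at integer times, and the martingale identity for f in the countable set S,
rational times and past events from a countable algebra. These suffice (`IsGoodCode.isSolution`):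
right limits reach real times, a monotone class argument reaches all past events, and the bp-closure
reaches all of the domain. Conversely every solution that is continuous in probability yields a good
code (`IsSolution.exists_isGoodCode`).

By uniqueness, the finite-dimensional distributions at x can be read off from any good code for x.
So the set of x where they satisfy a measurable condition is a projection of a Borel set, as is its
complement; both are analytic, hence Borel (`measurable_of_measurableSet_relation`). Passing from
probabilities of events to the function spaces only requires that the Borel fields there are
generated by countably many evaluations. -/

namespace MartingaleProblem

/-! ### The weak topology: second countability and Borel field. -/

section WeakTopology

variable {S : Type*} [MetricSpace S] [SecondCountableTopology S]

/-- The complement of a finite union of elements of the countable basis. -/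
def cobasisSet (T : Finset (TopologicalSpace.countableBasis S)) : Set S :=
  (⋃ t ∈ T, (t : Set S))ᶜ

theorem isClosed_cobasisSet (T : Finset (TopologicalSpace.countableBasis S)) :
    IsClosed (cobasisSet T) :=
  (isOpen_biUnion fun t _ =>
    TopologicalSpace.isOpen_of_mem_countableBasis t.2).isClosed_compl

variable [MeasurableSpace S] [BorelSpace S]

/-- The integrals of a probability measure against a countable family of functions that
determines the weak topology. -/
noncomputable def weakCoordinates (μ : ProbabilityMeasure S)
    (i : Finset (TopologicalSpace.countableBasis S) × ℕ) : ℝ≥0∞ :=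
  ∫⁻ x, thickenedIndicator (Nat.one_div_pos_of_nat (α := ℝ) (n := i.2)) (cobasisSet i.1) x
    ∂(μ : Measure S)

/-- Finitely many basis sets inside G already carry mass above r. The closed complement of their
union then has mass below 1 - r, and so does a sufficiently thin thickening, since the integrals of
the thickened indicators converge to that mass. -/
theorem exists_weakCoordinates_lt (μ : ProbabilityMeasure S) {G : Set S} (hG : IsOpen G)
    {r : ℝ≥0} (hr : r < μ G) :
    ∃ T k, weakCoordinates μ (T, k) < 1 - (r : ℝ≥0∞) ∧ (cobasisSet T)ᶜ ⊆ G := by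
  classical
  obtain ⟨T, hT, hrT, hTG⟩ := μ.exists_lt_measure_biUnion_of_isOpen
    (S := TopologicalSpace.countableBasis S) (fun u hu x hx => by
      obtain ⟨v, hv, hxv, hvu⟩ :=
        (TopologicalSpace.isBasis_countableBasis S).exists_subset_of_mem_open hx hu
      exact ⟨v, hv, (TopologicalSpace.isOpen_of_mem_countableBasis hv).mem_nhds hxv, hvu⟩) hG hr
  let T' : Finset (TopologicalSpace.countableBasis S) :=
    T.subtype (· ∈ TopologicalSpace.countableBasis S)
  have hU : (cobasisSet T')ᶜ = ⋃ t ∈ T, t := by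
    ext x
    simp only [cobasisSet, compl_compl, Set.mem_iUnion, T', Finset.mem_subtype]
    exact ⟨fun ⟨t, ht, hx⟩ => ⟨t, ht, hx⟩, fun ⟨t, ht, hx⟩ => ⟨⟨t, hT t ht⟩, ht, hx⟩⟩
  have hlt : (μ : Measure S) (cobasisSet T') < 1 - (r : ℝ≥0∞) := by
    rw [← hU] at hrT
    have h1 : (r : ℝ≥0∞) < (μ : Measure S) (cobasisSet T')ᶜ := by
      rw [← ProbabilityMeasure.ennreal_coeFn_eq_coeFn_toMeasure]
      exact_mod_cast hrT
    have h2 := prob_add_prob_compl (μ := (μ : Measure S)) (isClosed_cobasisSet T').measurableSet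
    rw [lt_tsub_iff_right, ← h2]
    exact (ENNReal.add_lt_add_iff_left (measure_ne_top _ _)).2 h1
  have hlim := tendsto_lintegral_thickenedIndicator_of_isClosed (μ : Measure S)
    (isClosed_cobasisSet T') (fun n => Nat.one_div_pos_of_nat (α := ℝ) (n := n))
    tendsto_one_div_add_atTop_nhds_zero_nat
  obtain ⟨k, hk⟩ := ((tendsto_order.1 hlim).2 _ hlt).exists
  exact ⟨T', k, hk, hU.trans_subset hTG⟩

theorem lt_measure_of_weakCoordinates_lt (μ : ProbabilityMeasure S) {G : Set S} {r : ℝ≥0}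
    {T : Finset (TopologicalSpace.countableBasis S)} {k : ℕ}
    (h : weakCoordinates μ (T, k) < 1 - (r : ℝ≥0∞)) (hT : (cobasisSet T)ᶜ ⊆ G) :
    (r : ℝ≥0∞) < (μ : Measure S) G := by
  have h1 : (μ : Measure S) (cobasisSet T) < 1 - (r : ℝ≥0∞) :=
    (measure_le_lintegral_thickenedIndicator (μ : Measure S)
      (isClosed_cobasisSet T).measurableSet _).trans_lt h
  rw [lt_tsub_iff_right,
    ← prob_add_prob_compl (μ := (μ : Measure S)) (isClosed_cobasisSet T).measurableSet] at h1
  exact ((ENNReal.add_lt_add_iff_left (measure_ne_top _ _)).1 h1).trans_le (measure_mono hT)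

/-- By the portmanteau theorem, convergence follows from lower bounds on the masses of open sets,
and a strict upper bound on a single coordinate, stable under small changes, certifies each of
these. -/
theorem isInducing_weakCoordinates : IsInducing (weakCoordinates (S := S)) := by
  refine isInducing_iff_nhds.2 fun μ => le_antisymm ?_ ?_
  · refine Tendsto.le_comap (tendsto_pi_nhds.2 fun i => ?_)
    exact ProbabilityMeasure.tendsto_iff_forall_lintegral_tendsto.1 tendsto_id _
  · have : Tendsto (fun ν : ProbabilityMeasure S => ν)
        (comap weakCoordinates (𝓝 (weakCoordinates μ))) (𝓝 μ) := by
      refine tendsto_of_forall_isOpen_le_liminf' fun G hG => le_of_forall_lt fun r hr => ?_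
      obtain ⟨r', hrr', hr'⟩ := ENNReal.lt_iff_exists_nnreal_btwn.1 hr
      refine hrr'.trans_le (le_liminf_of_le (by isBoundedDefault) ?_)
      rw [← ProbabilityMeasure.ennreal_coeFn_eq_coeFn_toMeasure] at hr'
      obtain ⟨T, k, hk, hTG⟩ := exists_weakCoordinates_lt μ hG (ENNReal.coe_lt_coe.1 hr')
      have h1 : Tendsto (fun ν => weakCoordinates ν (T, k))
          (comap weakCoordinates (𝓝 (weakCoordinates μ))) (𝓝 (weakCoordinates μ (T, k))) :=
        ((continuous_apply (T, k)).tendsto (weakCoordinates μ)).comp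
          (f := weakCoordinates) tendsto_comap
      filter_upwards [(tendsto_order.1 h1).2 _ hk] with ν hν
      exact (lt_measure_of_weakCoordinates_lt ν hν hTG).le
    exact this

instance secondCountableTopology_probabilityMeasure :
    SecondCountableTopology (ProbabilityMeasure S) :=
  isInducing_weakCoordinates.secondCountableTopology

/-- The Borel field is pulled back from a countable product by `weakCoordinates`, and each
coordinate is an integral, hence measurable in the measure. -/
theorem measurable_borel_probabilityMeasure {α : Type*} [MeasurableSpace α]
    {ν : α → ProbabilityMeasure S}
    (h : ∀ B : Set S, MeasurableSet B → Measurable fun x => (ν x : Measure S) B) :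
    Measurable[_, borel (ProbabilityMeasure S)] ν := by
  have hν : Measurable fun x => (ν x : Measure S) := Measure.measurable_of_measurable_coe _ h
  have e : borel (ProbabilityMeasure S)
      = MeasurableSpace.comap weakCoordinates MeasurableSpace.pi := by
    rw [BorelSpace.measurable_eq
      (α := Finset (TopologicalSpace.countableBasis S) × ℕ → ℝ≥0∞), ← borel_comap,
      ← isInducing_weakCoordinates.eq_induced]
  rw [e, measurable_comap_iff]
  refine measurable_pi_iff.2 fun i => ?_
  exact (Measure.measurable_lintegral (by fun_prop)).comp hν

end WeakTopology

/-! ### The Borel field of the compact-open topology. -/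

/-- The compact image of K has a uniform distance to the complement of U, and a non-strict lower
bound on the distance passes from D to its closure. The extended distance covers an empty
complement. A subbasic open set thus depends on countably many evaluations. -/
theorem mapsTo_iff_exists_le_infEDist {X Y : Type*} [TopologicalSpace X] [PseudoMetricSpace Y]
    {f : X → Y} (hf : Continuous f) {K D : Set X} (hK : IsCompact K) (hDK : D ⊆ K)
    (hKD : K ⊆ closure D) {U : Set Y} (hU : IsOpen U) :
    Set.MapsTo f K U ↔
      ∃ n : ℕ, ∀ t ∈ D, ((n : ℝ≥0∞) + 1)⁻¹ ≤ Metric.infEDist (f t) Uᶜ := by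
  constructor
  · intro h
    obtain ⟨δ, hδ, hsub⟩ := (hK.image hf).exists_thickening_subset_open hU h.image_subset
    obtain ⟨n, hn⟩ := ENNReal.exists_inv_nat_lt (ENNReal.ofReal_pos.2 hδ).ne'
    refine ⟨n, fun t ht => ?_⟩
    refine (ENNReal.inv_le_inv.2 le_self_add).trans (hn.le.trans ?_)
    refine Metric.le_infEDist.2 fun z hz => ?_
    by_contra! hlt
    refine hz (hsub (Metric.mem_thickening_iff.2 ⟨f t, ⟨t, hDK ht, rfl⟩, ?_⟩))
    rw [edist_comm, edist_dist] at hlt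
    exact (ENNReal.ofReal_lt_ofReal_iff hδ).1 hlt
  · rintro ⟨n, hn⟩ t ht
    have hcl : IsClosed {t | ((n : ℝ≥0∞) + 1)⁻¹ ≤ Metric.infEDist (f t) Uᶜ} :=
      isClosed_le continuous_const (Metric.continuous_infEDist.comp hf)
    have h1 : ((n : ℝ≥0∞) + 1)⁻¹ ≤ Metric.infEDist (f t) Uᶜ :=
      closure_minimal hn hcl (hKD ht)
    by_contra hU'
    rw [Metric.infEDist_zero_of_mem (show f t ∈ Uᶜ from hU')] at h1
    simp at h1

theorem measurable_borel_continuousMap {α X Y : Type*} [MeasurableSpace α] [TopologicalSpace X]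
    [SecondCountableTopology X] [LocallyCompactSpace X] [TopologicalSpace Y]
    [TopologicalSpace.PseudoMetrizableSpace Y] [SecondCountableTopology Y] {F : α → C(X, Y)}
    (h : ∀ t, Measurable[_, borel Y] fun a => F a t) : Measurable[_, borel C(X, Y)] F := by
  let _ := TopologicalSpace.pseudoMetrizableSpacePseudoMetric Y
  let _ : MeasurableSpace Y := borel Y
  have : BorelSpace Y := ⟨rfl⟩
  rw [borel_eq_generateFrom_of_subbasis ContinuousMap.compactOpen_eq]
  refine @measurable_generateFrom _ _ _ _ _ ?_
  rintro _ ⟨K, hK, U, hU, rfl⟩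
  obtain ⟨D, hDK, hDc, hKD⟩ : ∃ D ⊆ K, D.Countable ∧ K ⊆ closure D := by
    obtain ⟨D, hDc, hD⟩ := TopologicalSpace.exists_countable_dense K
    refine ⟨(↑) '' D, by simp, hDc.image _, fun x hx => ?_⟩
    exact image_closure_subset_closure_image continuous_subtype_val ⟨⟨x, hx⟩, hD _, rfl⟩
  have e : F ⁻¹' {f | Set.MapsTo f K U}
      = ⋃ n : ℕ, ⋂ t ∈ D, {a | ((n : ℝ≥0∞) + 1)⁻¹ ≤ Metric.infEDist (F a t) Uᶜ} := by
    ext a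
    simp only [Set.mem_preimage, Set.mem_iUnion, Set.mem_iInter]
    exact mapsTo_iff_exists_le_infEDist (F a).continuous hK hDK hKD hU
  rw [e]
  refine .iUnion fun n => .biInter hDc fun t _ => measurableSet_le measurable_const ?_
  exact Metric.continuous_infEDist.measurable.comp (h t)

/-! ### Analytic sets, and a Borel parametrization of all laws. -/

/-- A map whose values can be read off from any point of the fibres of a Borel relation is Borel
measurable, since its level sets and their complements are analytic. -/
theorem measurable_of_measurableSet_relation {E C β : Type*} [TopologicalSpace E] [PolishSpace E]
    [MeasurableSpace E] [BorelSpace E] [MeasurableSpace C] [StandardBorelSpace C]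
    [MeasurableSpace β] {R : Set (E × C)} (hR : MeasurableSet R) {g : C → β} (hg : Measurable g)
    {f : E → β} (hex : ∀ x, ∃ c, (x, c) ∈ R) (heq : ∀ x c, (x, c) ∈ R → f x = g c) :
    Measurable f := by
  have key : ∀ V : Set β, MeasurableSet V → AnalyticSet (f ⁻¹' V) := fun V hV => by
    have e : f ⁻¹' V = Prod.fst '' (R ∩ (fun p : E × C => g p.2) ⁻¹' V) := by
      ext x
      constructor
      · intro hx
        obtain ⟨c, hc⟩ := hex x
        exact ⟨(x, c), ⟨hc, by simpa [← heq x c hc] using hx⟩, rfl⟩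
      · rintro ⟨⟨x, c⟩, ⟨hc, hV⟩, rfl⟩
        simpa [heq x c hc] using hV
    rw [e]
    exact (hR.inter (hg.comp measurable_snd hV)).analyticSet_image measurable_fst
  exact fun V hV => (key V hV).measurableSet_of_compl (key Vᶜ hV.compl)

theorem isRatStieltjesPoint_cdf (ν : Measure ℝ) [IsProbabilityMeasure ν] :
    IsRatStieltjesPoint (id : (ℚ → ℝ) → ℚ → ℝ) (fun q => cdf ν q) where
  mono := fun a b hab => monotone_cdf ν (by exact_mod_cast hab)
  tendsto_atTop_one := (tendsto_cdf_atTop ν).comp (tendsto_ratCast_atTop_iff.2 tendsto_id)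
  tendsto_atBot_zero := (tendsto_cdf_atBot ν).comp (tendsto_ratCast_atBot_iff.2 tendsto_id)
  iInf_rat_gt_eq := fun t => by
    rw [id, ← (cdf ν).iInf_rat_gt_eq t]
    exact (Equiv.subtypeEquivRight fun r => (Rat.cast_lt (K := ℝ)).symm).iInf_congr fun _ => rfl

/-- There is a Markov kernel from a standard Borel space whose values exhaust the probability
measures on a given standard Borel space. -/
theorem exists_kernel_eq_of_isProbabilityMeasure (S : Type*) [MeasurableSpace S]
    [StandardBorelSpace S] [Nonempty S] :
    ∃ κ : Kernel (ℚ → ℝ) S, IsMarkovKernel κ ∧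
      ∀ ν : Measure S, IsProbabilityMeasure ν → ∃ z, κ z = ν := by
  -- `g` is a measurable left inverse of the embedding of S into ℝ, so it is enough to parametrize
  -- the laws on ℝ. There, `stieltjesOfMeasurableRat` turns every function on ℚ into a distribution
  -- function and leaves those that come from one unchanged.
  obtain ⟨g, hg, hge⟩ := (measurableEmbedding_embeddingReal S).exists_measurable_extend
    measurable_id fun _ => inferInstance
  let κ₀ : Kernel (ℚ → ℝ) ℝ :=
    ⟨fun z => (stieltjesOfMeasurableRat id measurable_id z).measure,
      measurable_measure_stieltjesOfMeasurableRat measurable_id⟩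
  have : IsMarkovKernel κ₀ :=
    ⟨fun z => ⟨measure_stieltjesOfMeasurableRat_univ measurable_id z⟩⟩
  refine ⟨κ₀.map g, Kernel.IsMarkovKernel.map _ hg, fun ν hν => ?_⟩
  let ν' : Measure ℝ := ν.map (embeddingReal S)
  have he := (measurableEmbedding_embeddingReal S).measurable
  have : IsProbabilityMeasure ν' := Measure.isProbabilityMeasure_map he.aemeasurable
  refine ⟨fun q => cdf ν' q, ?_⟩
  have hκ : κ₀ (fun q => cdf ν' q) = ν' := by
    have h : stieltjesOfMeasurableRat id measurable_id (fun q : ℚ => cdf ν' q) = cdf ν' := by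
      ext x
      rw [← StieltjesFunction.iInf_rat_gt_eq, ← StieltjesFunction.iInf_rat_gt_eq]
      refine iInf_congr fun r => ?_
      rw [stieltjesOfMeasurableRat_eq, toRatCDF_of_isRatStieltjesPoint (isRatStieltjesPoint_cdf ν')]
      rfl
    change (stieltjesOfMeasurableRat id measurable_id (fun q : ℚ => cdf ν' q)).measure = ν'
    rw [h, measure_cdf]
  rw [Kernel.map_apply _ hg, hκ, Measure.map_map hg he, hge, Measure.map_id]

/-! ### Almost sure limits from geometric probability bounds. -/

section BorelCantelli

variable {Ω E : Type*} [MeasurableSpace Ω] {P : Measure Ω} [PseudoMetricSpace E]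

theorem ae_eventually_notMem_of_eventually_le {s : ℕ → Set Ω}
    (h : ∀ᶠ k in atTop, P (s k) ≤ (1 / 2) ^ k) : ∀ᵐ ω ∂P, ∀ᶠ k in atTop, ω ∉ s k := by
  obtain ⟨k₀, hk₀⟩ := eventually_atTop.1 h
  have h1 : ∑' k, P (s (k + k₀)) ≠ ∞ := by
    refine ne_top_of_le_ne_top ?_ (ENNReal.tsum_le_tsum fun k => (hk₀ (k + k₀) (by omega)).trans
      (pow_le_pow_of_le_one (n := k + k₀) (m := k) zero_le (ENNReal.div_le_of_le_mul (by simp)) (by omega)))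
    rw [ENNReal.tsum_geometric]
    simp
  filter_upwards [ae_eventually_notMem h1] with ω hω
  exact (eventually_map (m := fun k => k + k₀) (P := fun k => ω ∉ s k)).2 hω |>.filter_mono
    (map_add_atTop_eq_nat k₀).ge

theorem ae_tendsto_of_eventually_measure_le {U : ℕ → Ω → E} {V : Ω → E}
    (h : ∀ᶠ k in atTop, P {ω | (1 / 2 : ℝ) ^ k ≤ dist (U k ω) (V ω)} ≤ (1 / 2) ^ k) :
    ∀ᵐ ω ∂P, Tendsto (fun k => U k ω) atTop (𝓝 (V ω)) := by
  filter_upwards [ae_eventually_notMem_of_eventually_le h] with ω hω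
  refine tendsto_iff_dist_tendsto_zero.2 (squeeze_zero' (.of_forall fun _ => dist_nonneg) ?_
    (tendsto_pow_atTop_nhds_zero_of_lt_one (r := (1 / 2 : ℝ)) (by norm_num) (by norm_num)))
  filter_upwards [hω] with k hk
  exact (not_le.1 hk).le

theorem ae_cauchySeq_of_eventually_measure_le {U : ℕ → Ω → E}
    (h : ∀ᶠ k in atTop, P {ω | (1 / 2 : ℝ) ^ k ≤ dist (U k ω) (U (k + 1) ω)} ≤ (1 / 2) ^ k) :
    ∀ᵐ ω ∂P, CauchySeq fun k => U k ω := by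
  filter_upwards [ae_eventually_notMem_of_eventually_le h] with ω hω
  obtain ⟨k₀, hk₀⟩ := eventually_atTop.1 hω
  refine (cauchySeq_shift k₀).1 (cauchySeq_of_le_geometric (1 / 2) 1 (by norm_num) fun n => ?_)
  have h1 := (not_le.1 (hk₀ (n + k₀) (by omega))).le
  rw [add_right_comm, one_mul]
  exact h1.trans (pow_le_pow_of_le_one (by norm_num) (by norm_num) (by omega))

/-- Where both sequences converge, a limiting distance of at least ε' > ε forces distances above ε
from some index on. These tail events increase, and each lies in an event of measure at most δ. -/
theorem measure_le_dist_le_of_ae_tendsto {U V : ℕ → Ω → E} {U' V' : Ω → E}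
    (hU : ∀ᵐ ω ∂P, Tendsto (fun k => U k ω) atTop (𝓝 (U' ω)))
    (hV : ∀ᵐ ω ∂P, Tendsto (fun k => V k ω) atTop (𝓝 (V' ω))) {ε ε' : ℝ} (hε : ε < ε') {δ : ℝ≥0∞}
    (h : ∀ᶠ k in atTop, P {ω | ε ≤ dist (U k ω) (V k ω)} ≤ δ) :
    P {ω | ε' ≤ dist (U' ω) (V' ω)} ≤ δ := by
  let s : ℕ → Set Ω := fun n => ⋂ k ≥ n, {ω | ε ≤ dist (U k ω) (V k ω)}
  have hs : Monotone s := fun a b hab => Set.biInter_subset_biInter_left fun k hk => hab.trans hk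
  calc P {ω | ε' ≤ dist (U' ω) (V' ω)} ≤ P (⋃ n, s n) := by
        refine measure_mono_ae ?_
        filter_upwards [hU, hV] with ω h1 h2 hω
        have h3 := (tendsto_order.1 (h1.dist h2)).1 ε (hε.trans_le hω)
        obtain ⟨n, hn⟩ := eventually_atTop.1 h3
        exact Set.mem_iUnion.2 ⟨n, Set.mem_iInter₂.2 fun k hk => (hn k hk).le⟩
    _ = ⨆ n, P (s n) := hs.measure_iUnion
    _ ≤ δ := by
        refine iSup_le fun n => ?_
        obtain ⟨k, hk, hkn⟩ := (h.and (eventually_ge_atTop n)).exists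
        exact (measure_mono (Set.biInter_subset_of_mem hkn)).trans hk

end BorelCantelli

end MartingaleProblem
namespace MartingaleProblem

/-! ### Time integrals: adaptedness, integrability and limits. -/

section PathIntegral

/-- The occupation measure of the path is a kernel: its masses of closed sets are limits of
integrals of continuous functions, and closed sets form a generating π-system. No joint
measurability in time and ω is assumed, so the σ-field may be the past at time t. This yields
adaptedness of the integrals of Borel functions without progressive measurability. -/
theorem measurable_setIntegral_of_boundedContinuous {Ω E : Type*} [MeasurableSpace Ω]
    [MetricSpace E] [MeasurableSpace E] [BorelSpace E] {Z : ℝ → Ω → E}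
    (hZ : ∀ ω, Measurable fun s => Z s ω) {t : ℝ}
    (h : ∀ f : E →ᵇ ℝ, Measurable fun ω => ∫ s in Set.Ioc 0 t, f (Z s ω))
    {g : E → ℝ} (hg : Measurable g) : Measurable fun ω => ∫ s in Set.Ioc 0 t, g (Z s ω) := by
  let Γ : Ω → Measure E := fun ω => (volume.restrict (Set.Ioc 0 t)).map fun s => Z s ω
  have hΓ : Measurable Γ := by
    refine Measurable.measure_of_isPiSystem (BorelSpace.measurable_eq.trans
      borel_eq_generateFrom_isClosed) isPiSystem_isClosed (fun F hF => ?_) ?_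
    · refine measurable_of_tendsto_metrizable (f := fun n ω => ∫⁻ x, thickenedIndicator
        (Nat.one_div_pos_of_nat (α := ℝ) (n := n)) F x ∂Γ ω) (fun n => ?_) (tendsto_pi_nhds.2 fun ω =>
          tendsto_lintegral_thickenedIndicator_of_isClosed (Γ ω) hF _
            tendsto_one_div_add_atTop_nhds_zero_nat)
      -- `h` speaks of real-valued test functions, so `ψ` is the real-valued version of the
      -- thickened indicator `φ`.
      let φ : E →ᵇ ℝ≥0 := thickenedIndicator (Nat.one_div_pos_of_nat (α := ℝ) (n := n)) F
      let ψ : E →ᵇ ℝ := BoundedContinuousFunction.comp _ (NNReal.isometry_coe.lipschitz) φ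
      have e : (fun ω => ∫⁻ x, (φ x : ℝ≥0∞) ∂Γ ω)
          = fun ω => ENNReal.ofReal (∫ s in Set.Ioc 0 t, ψ (Z s ω)) := by
        funext ω
        have h1 : ∫ s in Set.Ioc 0 t, ψ (Z s ω) = ∫ x, ψ x ∂Γ ω :=
          (integral_map (hZ ω).aemeasurable
            ψ.continuous.measurable.aestronglyMeasurable).symm
        rw [h1, ofReal_integral_eq_lintegral_ofReal (ψ.integrable _)
          (.of_forall fun x => (φ x).2)]
        exact lintegral_congr fun x => (ENNReal.ofReal_coe_nnreal (p := φ x)).symm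
      exact e ▸ (h ψ).ennreal_ofReal
    · have e : (fun ω => Γ ω Set.univ) = fun _ => volume (Set.Ioc 0 t) := by
        funext ω
        rw [Measure.map_apply (hZ ω) .univ]
        simp
      exact e ▸ measurable_const
  let κ : Kernel Ω E := ⟨Γ, hΓ⟩
  have e : (fun ω => ∫ s in Set.Ioc 0 t, g (Z s ω)) = fun ω => ∫ x, g x ∂κ ω := by
    funext ω
    exact (integral_map (hZ ω).aemeasurable hg.aestronglyMeasurable).symm
  exact e ▸ (StronglyMeasurable.integral_kernel (κ := κ) hg.stronglyMeasurable).measurable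

theorem pathIntegral_eq_setIntegral {E Ω : Type u} (g : E → ℝ) (X : ℝ≥0 → Ω → E) (t : ℝ≥0)
    (ω : Ω) : pathIntegral g X t ω = ∫ s in Set.Ioc (0 : ℝ) t, g (X s.toNNReal ω) :=
  intervalIntegral.integral_of_le t.2

theorem norm_pathIntegral_le {E Ω : Type u} {X : ℝ≥0 → Ω → E} {Φ : E → ℝ≥0}
    {g : E → ℝ} {C : ℝ} (hC : 0 ≤ C) (hgC : ∀ x, |g x| ≤ C * Φ x)
    {t T : ℝ≥0} (htT : t ≤ T) {ω : Ω}
    (hω : IntegrableOn (fun s : ℝ => (Φ (X s.toNNReal ω) : ℝ)) (Set.Ioc 0 T)) :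
    ‖pathIntegral g X t ω‖ ≤ C * pathIntegral (fun x => (Φ x : ℝ)) X T ω := by
  have hsub : Set.Ioc (0 : ℝ) t ⊆ Set.Ioc 0 T := Set.Ioc_subset_Ioc_right htT
  rw [pathIntegral_eq_setIntegral, pathIntegral_eq_setIntegral, ← integral_const_mul]
  refine (norm_integral_le_of_norm_le ((hω.mono_set hsub).const_mul C)
    (.of_forall fun s => hgC _)).trans ?_
  exact setIntegral_mono_set (hω.const_mul C)
    (.of_forall fun s => mul_nonneg hC (Φ _).2) hsub.eventuallyLE

variable {E Ω : Type u} [MeasurableSpace E] [mΩ : MeasurableSpace Ω] {X : ℝ≥0 → Ω → E}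

theorem IsMeasurableProcess.measurable_path (hX : IsMeasurableProcess X) (ω : Ω) :
    Measurable fun s : ℝ => X s.toNNReal ω :=
  hX.comp (measurable_real_toNNReal.prodMk measurable_const)

theorem IsMeasurableProcess.measurable_eval (hX : IsMeasurableProcess X) (t : ℝ≥0) :
    Measurable (X t) :=
  hX.comp (measurable_const.prodMk measurable_id)

theorem measurable_starFiltration_pathIntegral [MetricSpace E] [BorelSpace E]
    (hX : IsMeasurableProcess X) {g : E → ℝ} (hg : Measurable g) (t : ℝ≥0) :
    Measurable[starFiltration X hX t] (pathIntegral g X t) := by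
  simp only [funext (pathIntegral_eq_setIntegral g X t)]
  refine @measurable_setIntegral_of_boundedContinuous Ω E (starFiltration X hX t) _ _ _
    (fun s ω => X s.toNNReal ω) hX.measurable_path t (fun f => ?_) g hg
  have h1 : MeasurableSpace.comap (pathIntegral (fun x => f x) X t) inferInstance
      ≤ starFiltration X hX t :=
    ((le_iSup (fun h : E →ᵇ ℝ =>
      MeasurableSpace.comap (pathIntegral (fun x => h x) X t) inferInstance) f).trans
      le_sup_right).trans (le_iSup₂ (f := fun (v : ℝ≥0) (_ : v ≤ t) =>
        MeasurableSpace.comap (X v) inferInstance ⊔ ⨆ h : E →ᵇ ℝ,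
          MeasurableSpace.comap (pathIntegral (fun x => h x) X v) inferInstance) t le_rfl)
  have h2 := (measurable_iff_comap_le.2 h1)
  simpa only [funext (pathIntegral_eq_setIntegral (fun x => f x) X t)] using h2

theorem measurable_starFiltration_eval [MetricSpace E] [BorelSpace E]
    (hX : IsMeasurableProcess X) {s t : ℝ≥0} (hst : s ≤ t) :
    Measurable[starFiltration X hX t] (X s) := by
  refine measurable_iff_comap_le.2 ?_
  exact le_sup_left.trans (le_iSup₂ (f := fun (v : ℝ≥0) (_ : v ≤ t) =>
        MeasurableSpace.comap (X v) inferInstance ⊔ ⨆ h : E →ᵇ ℝ,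
          MeasurableSpace.comap (pathIntegral (fun x => h x) X v) inferInstance) s hst)

variable {P : Measure Ω} {Φ : E → ℝ≥0}

/-- The time integral `∫₀ᵗ Φ(X_s) ds` has finite expectation for all `t`. -/
def HasIntegrableCost (Φ : E → ℝ≥0) (P : Measure Ω) (X : ℝ≥0 → Ω → E) : Prop :=
  ∀ T : ℝ≥0, ∫⁻ ω, ∫⁻ s in Set.Ioc (0 : ℝ) (T : ℝ), (Φ (X s.toNNReal ω) : ℝ≥0∞) ∂volume ∂P < ∞

theorem measurable_lintegral_path (hΦ : Measurable Φ) (hX : IsMeasurableProcess X) (T : ℝ) :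
    Measurable fun ω => ∫⁻ s in Set.Ioc (0 : ℝ) T, (Φ (X s.toNNReal ω) : ℝ≥0∞) := by
  have h : Measurable fun p : Ω × ℝ => (Φ (X p.2.toNNReal p.1) : ℝ≥0∞) :=
    (hΦ.comp (hX.comp ((measurable_real_toNNReal.comp measurable_snd).prodMk
      measurable_fst))).coe_nnreal_ennreal
  exact h.lintegral_prod_right'

theorem HasIntegrableCost.ae_integrableOn (hc : HasIntegrableCost Φ P X) (hΦ : Measurable Φ)
    (hX : IsMeasurableProcess X) (T : ℝ≥0) :
    ∀ᵐ ω ∂P, IntegrableOn (fun s : ℝ => (Φ (X s.toNNReal ω) : ℝ)) (Set.Ioc 0 T) := by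
  filter_upwards [ae_lt_top (measurable_lintegral_path hΦ hX T) (hc T).ne] with ω hω
  refine ⟨(hΦ.comp (hX.measurable_path ω)).coe_nnreal_real.aestronglyMeasurable, ?_⟩
  simpa [HasFiniteIntegral] using hω

theorem HasIntegrableCost.integrable_pathIntegral (hc : HasIntegrableCost Φ P X)
    (hΦ : Measurable Φ) (hX : IsMeasurableProcess X) (T : ℝ≥0) :
    Integrable (pathIntegral (fun x => (Φ x : ℝ)) X T) P := by
  refine ⟨(measurable_pathIntegral hΦ.coe_nnreal_real hX T).aestronglyMeasurable, ?_⟩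
  refine (lintegral_mono fun ω => ?_).trans_lt (hc T)
  rw [pathIntegral_eq_setIntegral]
  refine (enorm_integral_le_lintegral_enorm _).trans_eq ?_
  simp

theorem tendsto_pathIntegral {g : ℕ → E → ℝ} {g' : E → ℝ} {C : ℝ}
    (hX : IsMeasurableProcess X) (hg : ∀ j, Measurable (g j))
    (hgC : ∀ j x, |g j x| ≤ C * Φ x) (hlim : ∀ x, Tendsto (fun j => g j x) atTop (𝓝 (g' x)))
    {u : ℕ → ℝ≥0} {t T : ℝ≥0} (hu : Tendsto u atTop (𝓝 t)) (huT : ∀ j, u j ≤ T) {ω : Ω}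
    (hω : IntegrableOn (fun s : ℝ => (Φ (X s.toNNReal ω) : ℝ)) (Set.Ioc 0 T)) :
    Tendsto (fun j => pathIntegral (g j) X (u j) ω) atTop (𝓝 (pathIntegral g' X t ω)) := by
  have htT : t ≤ T := le_of_tendsto' hu huT
  have e : ∀ (g : E → ℝ) (t : ℝ≥0), t ≤ T → pathIntegral g X t ω
      = ∫ s in Set.Ioc (0 : ℝ) T, (Set.Ioc (0 : ℝ) t).indicator (fun s => g (X s.toNNReal ω)) s := by
    intro g t ht
    rw [pathIntegral_eq_setIntegral, setIntegral_indicator measurableSet_Ioc,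
      Set.inter_eq_right.2 (Set.Ioc_subset_Ioc_right (NNReal.coe_le_coe.2 ht))]
  simp only [e _ _ htT, e _ _ (huT _)]
  refine tendsto_integral_of_dominated_convergence
    (fun s => C * (Φ (X s.toNNReal ω) : ℝ)) (fun j => ?_) (hω.const_mul C)
    (fun j => .of_forall fun s => ?_) ?_
  · exact (((hg j).comp (hX.measurable_path ω)).indicator measurableSet_Ioc).aestronglyMeasurable
  · exact (norm_indicator_le_norm_self _ _).trans (hgC j _)
  -- The indicators of (0, u j] may fail to converge to that of (0, t] only at the single time s =
  -- t.
  · have hne : ∀ᵐ s ∂(volume.restrict (Set.Ioc (0 : ℝ) T)), s ≠ (t : ℝ) :=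
      ae_restrict_of_ae (Measure.ae_ne volume (t : ℝ))
    have hu' : Tendsto (fun j => (u j : ℝ)) atTop (𝓝 t) := NNReal.tendsto_coe.2 hu
    filter_upwards [hne] with s hs
    rcases lt_or_gt_of_ne hs with h | h
    · by_cases h0 : 0 < s
      · rw [Set.indicator_of_mem (show s ∈ Set.Ioc (0 : ℝ) t from ⟨h0, h.le⟩)]
        refine (hlim _).congr' ?_
        filter_upwards [(tendsto_order.1 hu').1 s h] with j hj
        rw [Set.indicator_of_mem (show s ∈ Set.Ioc (0 : ℝ) (u j) from ⟨h0, hj.le⟩)]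
      · have : ∀ b : ℝ, s ∉ Set.Ioc (0 : ℝ) b := fun b hb => h0 hb.1
        simp only [Set.indicator_of_notMem (this _)]
        exact tendsto_const_nhds
    · rw [Set.indicator_of_notMem fun hs' : s ∈ Set.Ioc (0 : ℝ) t => h.not_ge hs'.2]
      refine tendsto_const_nhds.congr' ?_
      filter_upwards [(tendsto_order.1 hu').2 s h] with j hj
      rw [Set.indicator_of_notMem fun hs' : s ∈ Set.Ioc (0 : ℝ) (u j) => hj.not_ge hs'.2]

theorem tendsto_setIntegral_pathIntegral {g : ℕ → E → ℝ} {g' : E → ℝ} {C : ℝ} (hC : 0 ≤ C)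
    (hc : HasIntegrableCost Φ P X) (hΦ : Measurable Φ)
    (hX : IsMeasurableProcess X) (hg : ∀ j, Measurable (g j))
    (hgC : ∀ j x, |g j x| ≤ C * Φ x) (hlim : ∀ x, Tendsto (fun j => g j x) atTop (𝓝 (g' x)))
    {u : ℕ → ℝ≥0} {t : ℝ≥0} (hu : Tendsto u atTop (𝓝 t)) (H : Set Ω) :
    Tendsto (fun j => ∫ ω in H, pathIntegral (g j) X (u j) ω ∂P) atTop
      (𝓝 (∫ ω in H, pathIntegral g' X t ω ∂P)) := by
  obtain ⟨T, hT⟩ := hu.bddAbove_range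
  have huT : ∀ j, u j ≤ T := fun j => hT ⟨j, rfl⟩
  have hae := ae_restrict_of_ae (s := H) (hc.ae_integrableOn hΦ hX T)
  refine tendsto_integral_of_dominated_convergence
    (fun ω => C * pathIntegral (fun x => (Φ x : ℝ)) X T ω)
    (fun j => (measurable_pathIntegral (hg j) hX _).aestronglyMeasurable)
    ((hc.integrable_pathIntegral hΦ hX T).restrict.const_mul C) (fun j => ?_) ?_
  · filter_upwards [hae] with ω hω
    exact norm_pathIntegral_le hC (hgC j) (huT j) hω
  · filter_upwards [hae] with ω hω
    exact tendsto_pathIntegral hX hg hgC hlim hu huT hω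

theorem HasIntegrableCost.integrable_pathIntegral_of_le (hc : HasIntegrableCost Φ P X)
    (hΦ : Measurable Φ) (hX : IsMeasurableProcess X) {g : E → ℝ} (hg : Measurable g) {C : ℝ}
    (hC : 0 ≤ C) (hgC : ∀ x, |g x| ≤ C * Φ x) (t : ℝ≥0) : Integrable (pathIntegral g X t) P := by
  refine ((hc.integrable_pathIntegral hΦ hX t).const_mul C).mono'
    (measurable_pathIntegral hg hX t).aestronglyMeasurable ?_
  filter_upwards [hc.ae_integrableOn hΦ hX t] with ω hω
  exact norm_pathIntegral_le hC hgC le_rfl hω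

/-- Every subsequence has a further subsequence that converges almost surely, along which dominated
convergence applies. -/
theorem tendsto_setIntegral_of_tendstoInMeasure {E Ω : Type*} [MetricSpace E]
    [SecondCountableTopology E] [MeasurableSpace E] [BorelSpace E] [MeasurableSpace Ω]
    {P : Measure Ω} [IsFiniteMeasure P] {U : ℕ → Ω → E} {V : Ω → E} (hU : ∀ j, Measurable (U j))
    (h : TendstoInMeasure P U atTop V) (f : E →ᵇ ℝ) (H : Set Ω) :
    Tendsto (fun j => ∫ ω in H, f (U j ω) ∂P) atTop (𝓝 (∫ ω in H, f (V ω) ∂P)) := by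
  refine tendsto_of_subseq_tendsto fun ns hns => ?_
  have h' : TendstoInMeasure P (fun j => U (ns j)) atTop V := fun ε hε => (h ε hε).comp hns
  obtain ⟨ms, -, hms⟩ := h'.exists_seq_tendsto_ae
  refine ⟨ms, tendsto_integral_of_dominated_convergence (fun _ => ‖f‖)
    (fun j => (f.continuous.measurable.comp (hU _)).aestronglyMeasurable)
    (integrable_const _) (fun j => .of_forall fun ω => f.norm_coe_le_norm _) ?_⟩
  filter_upwards [ae_restrict_of_ae hms] with ω hω
  exact (f.continuous.tendsto _).comp hω

end PathIntegral

end MartingaleProblem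
namespace MartingaleProblem

/-! ### Grids of rational times below a real time. -/

section Grid

/-- The largest multiple of `1 / (n k + 1)` that does not exceed `t`. -/
noncomputable def gridPoint (n : ℕ → ℕ) (k : ℕ) (t : ℝ≥0) : ℚ≥0 :=
  (⌊t * (n k + 1)⌋₊ : ℚ≥0) / (n k + 1)

theorem coe_gridPoint (n : ℕ → ℕ) (k : ℕ) (t : ℝ≥0) :
    (gridPoint n k t : ℝ≥0) = ⌊t * (n k + 1)⌋₊ / (n k + 1) := by
  simp [gridPoint]

theorem gridPoint_le (n : ℕ → ℕ) (k : ℕ) (t : ℝ≥0) : (gridPoint n k t : ℝ≥0) ≤ t := by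
  rw [coe_gridPoint, div_le_iff₀ (by positivity)]
  exact Nat.floor_le (by positivity)

theorem le_gridPoint_add (n : ℕ → ℕ) (k : ℕ) (t : ℝ≥0) :
    (t : ℝ) ≤ (gridPoint n k t : ℝ≥0) + 1 / (n k + 1) := by
  have h : t ≤ (gridPoint n k t : ℝ≥0) + 1 / (n k + 1) := by
    rw [coe_gridPoint, ← add_div, le_div_iff₀ (by positivity)]
    exact (Nat.lt_floor_add_one _).le
  exact_mod_cast h

theorem dist_gridPoint_le (n : ℕ → ℕ) (k : ℕ) (t : ℝ≥0) :
    dist (gridPoint n k t : ℝ≥0) t ≤ 1 / (n k + 1) := by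
  have h1 : ((gridPoint n k t : ℝ≥0) : ℝ) ≤ t := gridPoint_le n k t
  have h2 := le_gridPoint_add n k t
  rw [NNReal.dist_eq, abs_le]
  constructor <;> linarith [show (0 : ℝ) ≤ 1 / (n k + 1) by positivity]

theorem dist_gridPoint_succ_le {n : ℕ → ℕ} (hn : StrictMono n) (k : ℕ) (t : ℝ≥0) :
    dist (gridPoint n k t : ℝ≥0) (gridPoint n (k + 1) t) ≤ 1 / (n k + 1) := by
  have h1 : ((gridPoint n k t : ℝ≥0) : ℝ) ≤ t := gridPoint_le n k t
  have h2 := le_gridPoint_add n k t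
  have h3 : ((gridPoint n (k + 1) t : ℝ≥0) : ℝ) ≤ t := gridPoint_le n (k + 1) t
  have h4 := le_gridPoint_add n (k + 1) t
  have h5 : (1 : ℝ) / (n (k + 1) + 1) ≤ 1 / (n k + 1) := by
    gcongr
    exact hn.monotone k.le_succ
  rw [NNReal.dist_eq, abs_le]
  constructor <;> linarith

theorem tendsto_gridPoint {n : ℕ → ℕ} (hn : StrictMono n) (t : ℝ≥0) :
    Tendsto (fun k => (gridPoint n k t : ℝ≥0)) atTop (𝓝 t) := by
  refine tendsto_iff_dist_tendsto_zero.2 (squeeze_zero (fun _ => dist_nonneg)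
    (fun k => dist_gridPoint_le n k t) ?_)
  exact tendsto_one_div_add_atTop_nhds_zero_nat.comp hn.tendsto_atTop

theorem measurableSet_gridPoint_eq (k : ℕ) (q : ℚ≥0) :
    MeasurableSet {p : (ℕ → ℕ) × ℝ≥0 | gridPoint p.1 k p.2 = q} := by
  have h : Measurable fun p : (ℕ → ℕ) × ℝ≥0 => (gridPoint p.1 k p.2 : ℝ≥0) := by
    simp only [coe_gridPoint]
    have h1 : Measurable fun p : (ℕ → ℕ) × ℝ≥0 => (p.1 k : ℝ≥0) + 1 :=
      ((measurable_from_top (f := fun m : ℕ => (m : ℝ≥0))).comp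
        ((measurable_pi_apply k).comp measurable_fst)).add_const 1
    have h2 : Measurable fun p : (ℕ → ℕ) × ℝ≥0 => (⌊p.2 * (p.1 k + 1)⌋₊ : ℝ≥0) :=
      (measurable_from_top (f := fun m : ℕ => (m : ℝ≥0))).comp
        (Nat.measurable_floor.comp (measurable_snd.mul h1))
    exact h2.div h1
  have e : {p : (ℕ → ℕ) × ℝ≥0 | gridPoint p.1 k p.2 = q}
      = (fun p : (ℕ → ℕ) × ℝ≥0 => (gridPoint p.1 k p.2 : ℝ≥0)) ⁻¹' {(q : ℝ≥0)} := by
    ext p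
    simp
  exact e ▸ h (measurableSet_singleton _)

end Grid

/-! ### Extending paths from rational to real times. -/

section RationalPath

variable {E : Type u}

/-- The path `ω`, defined at rational times, stopped from changing after time `u`: its values at
later times are replaced by the initial value. -/
noncomputable def truncatePath (u : ℝ≥0) (ω : ℚ≥0 → E) (q : ℚ≥0) : E :=
  open Classical in if (q : ℝ≥0) ≤ u then ω q else ω 0

theorem truncatePath_apply_of_le {u : ℝ≥0} (ω : ℚ≥0 → E) {q : ℚ≥0} (h : (q : ℝ≥0) ≤ u) :
    truncatePath u ω q = ω q := if_pos h

theorem truncatePath_truncatePath {s u : ℝ≥0} (h : s ≤ u) (ω : ℚ≥0 → E) :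
    truncatePath s (truncatePath u ω) = truncatePath s ω := by
  funext q
  by_cases h1 : (q : ℝ≥0) ≤ s
  · simp [truncatePath, h1, h1.trans h]
  · simp [truncatePath, h1]

theorem measurable_truncatePath [MeasurableSpace E] (u : ℝ≥0) :
    Measurable (truncatePath u : (ℚ≥0 → E) → ℚ≥0 → E) := by
  refine measurable_pi_iff.2 fun q => ?_
  unfold truncatePath
  split_ifs
  exacts [measurable_pi_apply q, measurable_pi_apply 0]

theorem IsMeasurableProcess.measurable_rationalPath {Ω : Type u} [MeasurableSpace Ω]
    [MeasurableSpace E] {X : ℝ≥0 → Ω → E} (hX : IsMeasurableProcess X) :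
    Measurable fun (ω : Ω) (q : ℚ≥0) => X q ω :=
  measurable_pi_iff.2 fun q => hX.measurable_eval q

variable [MetricSpace E] [Nonempty E]

/-- The extension of a path from rational to real times, as a limit along the grids given by
`n`. -/
noncomputable def extendPath (n : ℕ → ℕ) (t : ℝ≥0) (ω : ℚ≥0 → E) : E :=
  limUnder atTop fun k => ω (gridPoint n k t)

/-- Grid points never exceed t, so the extension does not look into the future. -/
theorem extendPath_truncatePath (n : ℕ → ℕ) {t u : ℝ≥0} (h : t ≤ u) (ω : ℚ≥0 → E) :
    extendPath n t (truncatePath u ω) = extendPath n t ω := by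
  unfold extendPath
  congr 1
  funext k
  exact truncatePath_apply_of_le ω ((gridPoint_le n k t).trans h)

variable [CompleteSpace E] [MeasurableSpace E]

/-- `n` is a modulus of continuity in probability of a law on paths at rational times. -/
def HasModulus (Q : Measure (ℚ≥0 → E)) (n : ℕ → ℕ) : Prop :=
  StrictMono n ∧ ∀ (k : ℕ) (q q' : ℚ≥0), (q : ℝ≥0) ≤ k → (q' : ℝ≥0) ≤ k →
    dist (q : ℝ≥0) (q' : ℝ≥0) ≤ 1 / (n k + 1) →
    Q {ω | (1 / 2 : ℝ) ^ k ≤ dist (ω q) (ω q')} ≤ (1 / 2) ^ k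

variable {Q : Measure (ℚ≥0 → E)} {n : ℕ → ℕ}

/-- Consecutive grid points are close enough for the k-th modulus condition once k ≥ t, so by
Borel–Cantelli the increments are eventually below (1/2)^k and completeness gives a limit. -/
theorem HasModulus.ae_tendsto (h : HasModulus Q n) (t : ℝ≥0) :
    ∀ᵐ ω ∂Q, Tendsto (fun k => ω (gridPoint n k t)) atTop (𝓝 (extendPath n t ω)) := by
  have h1 : ∀ᵐ ω ∂Q, CauchySeq fun k => ω (gridPoint n k t) := by
    refine ae_cauchySeq_of_eventually_measure_le (U := fun k (ω : ℚ≥0 → E) => ω (gridPoint n k t)) ?_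
    obtain ⟨k₀, hk₀⟩ := exists_nat_ge t
    filter_upwards [eventually_ge_atTop k₀] with k hk
    have htk : t ≤ k := hk₀.trans (by exact_mod_cast hk)
    exact h.2 k _ _ ((gridPoint_le n k t).trans htk) ((gridPoint_le n _ t).trans htk)
      (dist_gridPoint_succ_le h.1 k t)
  filter_upwards [h1] with ω hω
  exact tendsto_nhds_limUnder (cauchySeq_tendsto_of_complete hω)

theorem HasModulus.ae_eq (h : HasModulus Q n) (q : ℚ≥0) :
    ∀ᵐ ω ∂Q, extendPath n q ω = ω q := by
  have h1 : ∀ᵐ ω ∂Q, Tendsto (fun k => ω (gridPoint n k q)) atTop (𝓝 (ω q)) := by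
    refine ae_tendsto_of_eventually_measure_le (U := fun k (ω : ℚ≥0 → E) => ω (gridPoint n k q))
      (V := fun ω : ℚ≥0 → E => ω q) ?_
    obtain ⟨k₀, hk₀⟩ := exists_nat_ge (q : ℝ≥0)
    filter_upwards [eventually_ge_atTop k₀] with k hk
    have htk : (q : ℝ≥0) ≤ k := hk₀.trans (by exact_mod_cast hk)
    exact h.2 k _ _ ((gridPoint_le n k q).trans htk) htk (dist_gridPoint_le n k q)
  filter_upwards [h1, h.ae_tendsto q] with ω h2 h3
  exact tendsto_nhds_unique h3 h2

theorem HasModulus.measure_le (h : HasModulus Q n) {k : ℕ} {s t : ℝ≥0} (hs : s ≤ k) (ht : t ≤ k)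
    (hst : dist s t < 1 / (n k + 1)) {ε : ℝ} (hε : (1 / 2 : ℝ) ^ k < ε) :
    Q {ω | ε ≤ dist (extendPath n s ω) (extendPath n t ω)} ≤ (1 / 2) ^ k := by
  refine measure_le_dist_le_of_ae_tendsto (h.ae_tendsto s) (h.ae_tendsto t) hε ?_
  have h1 := (tendsto_order.1 ((tendsto_gridPoint h.1 s).dist (tendsto_gridPoint h.1 t))).2 _ hst
  filter_upwards [h1] with j hj
  exact h.2 k _ _ ((gridPoint_le n j s).trans hs) ((gridPoint_le n j t).trans ht) hj.le

theorem HasModulus.isContinuousInProbability (h : HasModulus Q n) :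
    IsContinuousInProbability Q (extendPath n) := by
  intro t
  rw [tendstoInMeasure_iff_dist]
  intro ε hε
  refine ENNReal.tendsto_nhds_zero.2 fun δ hδ => ?_
  have h1 := (tendsto_order.1 (tendsto_pow_atTop_nhds_zero_of_lt_one
    (r := (1 / 2 : ℝ)) (by norm_num) (by norm_num))).2 ε hε
  have h2 := (tendsto_order.1 (ENNReal.tendsto_pow_atTop_nhds_zero_of_lt_one
    (r := (1 / 2 : ℝ≥0∞)) (by simp))).2 δ hδ
  obtain ⟨k₀, hk₀⟩ := exists_nat_ge (t + 1)
  obtain ⟨k, ⟨hk1, hk2⟩, hk⟩ := ((h1.and h2).and (eventually_ge_atTop k₀)).exists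
  have htk : t + 1 ≤ k := hk₀.trans (by exact_mod_cast hk)
  have hpos : (0 : ℝ) < 1 / (n k + 1) := by positivity
  filter_upwards [Metric.ball_mem_nhds t hpos, eventually_lt_nhds (lt_add_one t)] with s hs hs'
  exact (h.measure_le (hs'.le.trans htk) (le_self_add.trans htk) hs hk1).trans hk2.le

variable [SecondCountableTopology E] [BorelSpace E]

theorem measurable_extendPath :
    Measurable fun p : ((ℕ → ℕ) × ℝ≥0) × (ℚ≥0 → E) => extendPath p.1.1 p.1.2 p.2 := by
  refine (StronglyMeasurable.limUnder fun k => ?_).measurable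
  refine Measurable.stronglyMeasurable fun V hV => ?_
  -- Grid points take countably many values, so evaluation at a variable grid point splits into
  -- evaluations at fixed rationals.
  have e : (fun p : ((ℕ → ℕ) × ℝ≥0) × (ℚ≥0 → E) => p.2 (gridPoint p.1.1 k p.1.2)) ⁻¹' V
      = ⋃ q : ℚ≥0, (Prod.fst ⁻¹' {p : (ℕ → ℕ) × ℝ≥0 | gridPoint p.1 k p.2 = q})
        ∩ Prod.snd ⁻¹' {ω : ℚ≥0 → E | ω q ∈ V} := by
    ext p
    simp
  rw [e]
  exact .iUnion fun q => (measurable_fst (measurableSet_gridPoint_eq k q)).inter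
    (measurable_snd (measurable_pi_apply q hV))

theorem isMeasurableProcess_extendPath (n : ℕ → ℕ) :
    IsMeasurableProcess (extendPath (E := E) n) :=
  measurable_extendPath.comp
    ((measurable_const.prodMk measurable_fst).prodMk measurable_snd)

end RationalPath

/-! ### The modulus of a process that is continuous in probability. -/

section Modulus

variable {E Ω : Type u} [MetricSpace E] [MeasurableSpace Ω] {P : Measure Ω} {X : ℝ≥0 → Ω → E}

/-- Continuity in probability is uniform on [0, T] by compactness: pairs of times that violate the
bound would accumulate at a common time a, where both values are close to X a in probability. -/
theorem IsContinuousInProbability.exists_forall_measure_le (hc : IsContinuousInProbability P X)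
    (T : ℝ≥0) {ε : ℝ} (hε : 0 < ε) {δ : ℝ≥0∞} (hδ : 0 < δ) :
    ∃ N : ℕ, ∀ s t : ℝ≥0, s ≤ T → t ≤ T → dist s t ≤ 1 / (N + 1) →
      P {ω | ε ≤ dist (X s ω) (X t ω)} ≤ δ := by
  by_contra! hcon
  choose s t hs ht hst hP using hcon
  obtain ⟨a, -, φ, hφ, ha⟩ := (isCompact_Icc (a := (0 : ℝ≥0)) (b := T)).tendsto_subseq
    fun N => ⟨zero_le, hs N⟩
  have hb : Tendsto (t ∘ φ) atTop (𝓝 a) := by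
    refine tendsto_iff_dist_tendsto_zero.2 ?_
    have h1 : Tendsto (fun j => 1 / ((φ j : ℝ) + 1) + dist (s (φ j)) a) atTop (𝓝 (0 + 0)) :=
      (tendsto_one_div_add_atTop_nhds_zero_nat.comp hφ.tendsto_atTop).add
        (tendsto_iff_dist_tendsto_zero.1 ha)
    rw [add_zero] at h1
    refine squeeze_zero (fun _ => dist_nonneg) (fun j => ?_) h1
    refine (dist_triangle _ (s (φ j)) _).trans (add_le_add_left ?_ _)
    rw [dist_comm]
    exact hst _
  have hX := tendstoInMeasure_iff_dist.1 (hc a) (ε / 2) (half_pos hε)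
  have h1 := (hX.comp ha).add (hX.comp hb)
  rw [add_zero] at h1
  obtain ⟨j, hj⟩ := ((tendsto_order.1 h1).2 δ hδ).exists
  refine absurd ((hP (φ j)).trans_le ((measure_mono fun ω hω => ?_).trans
    (measure_union_le _ _))) hj.not_gt
  by_contra! hω'
  simp only [Set.mem_union, Set.mem_ofPred_eq, not_or, not_le] at hω'
  have h2 : ε ≤ dist (X (s (φ j)) ω) (X (t (φ j)) ω) := hω
  have h3 := dist_triangle_right (X (s (φ j)) ω) (X (t (φ j)) ω) (X a ω)
  simp only [Function.comp] at hω'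
  linarith [hω'.1, hω'.2]

theorem IsContinuousInProbability.exists_strictMono (hc : IsContinuousInProbability P X) :
    ∃ n : ℕ → ℕ, StrictMono n ∧ ∀ (k : ℕ) (s t : ℝ≥0), s ≤ k → t ≤ k →
      dist s t ≤ 1 / (n k + 1) → P {ω | (1 / 2 : ℝ) ^ k ≤ dist (X s ω) (X t ω)} ≤ (1 / 2) ^ k := by
  have h (k : ℕ) := hc.exists_forall_measure_le (k : ℝ≥0) (ε := (1 / 2) ^ k) (by positivity)
    (δ := (1 / 2) ^ k) (ENNReal.pow_pos (by simp) k)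
  choose m hm using h
  -- Partial sums of m i + 1 increase strictly and dominate m k, so they only shrink the admissible
  -- gap.
  refine ⟨fun k => ∑ i ∈ Finset.range (k + 1), (m i + 1), strictMono_nat_of_lt_succ fun k => ?_,
    fun k s t hs ht hst => hm k s t hs ht (hst.trans ?_)⟩
  · rw [Finset.sum_range_succ _ (k + 1)]
    omega
  · gcongr
    exact (Nat.le_succ _).trans (Finset.single_le_sum (f := fun i => m i + 1)
      (fun _ _ => zero_le) (Finset.self_mem_range_succ k))

theorem ae_extendPath_eq [Nonempty E] {n : ℕ → ℕ}
    (hn : ∀ (k : ℕ) (s t : ℝ≥0), s ≤ k → t ≤ k → dist s t ≤ 1 / (n k + 1) →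
      P {ω | (1 / 2 : ℝ) ^ k ≤ dist (X s ω) (X t ω)} ≤ (1 / 2) ^ k) (t : ℝ≥0) :
    ∀ᵐ ω ∂P, extendPath n t (fun q => X q ω) = X t ω := by
  have h1 : ∀ᵐ ω ∂P, Tendsto (fun k => X (gridPoint n k t) ω) atTop (𝓝 (X t ω)) := by
    refine ae_tendsto_of_eventually_measure_le (U := fun k ω => X (gridPoint n k t) ω) ?_
    obtain ⟨k₀, hk₀⟩ := exists_nat_ge t
    filter_upwards [eventually_ge_atTop k₀] with k hk
    have htk : t ≤ k := hk₀.trans (by exact_mod_cast hk)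
    exact hn k _ _ ((gridPoint_le n k t).trans htk) htk (dist_gridPoint_le n k t)
  filter_upwards [h1] with ω hω
  exact hω.limUnder_eq

end Modulus

end MartingaleProblem
namespace MartingaleProblem

/-! ### Martingale identities and their stability under limits. -/

section Compensated

/-- The process `f(X_t) - ∫₀ᵗ g(X_s) ds`. -/
noncomputable def compensatedProcess {E Ω : Type u} (f g : E → ℝ) (X : ℝ≥0 → Ω → E) (t : ℝ≥0)
    (ω : Ω) : ℝ :=
  f (X t ω) - pathIntegral g X t ω

variable {E Ω : Type u} [MeasurableSpace E] [mΩ : MeasurableSpace Ω] {X : ℝ≥0 → Ω → E}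
  {P : Measure Ω} [IsProbabilityMeasure P] {Φ : E → ℝ≥0}

theorem measurable_compensatedProcess (hX : IsMeasurableProcess X) {f g : E → ℝ}
    (hf : Measurable f) (hg : Measurable g) (t : ℝ≥0) :
    Measurable (compensatedProcess f g X t) :=
  (hf.comp (hX.measurable_eval t)).sub (measurable_pathIntegral hg hX t)

theorem integrable_comp_of_abs_le (hX : IsMeasurableProcess X) {f : E → ℝ} (hf : Measurable f)
    {K : ℝ} (hK : ∀ x, |f x| ≤ K) (t : ℝ≥0) : Integrable (fun ω => f (X t ω)) P :=
  (integrable_const K).mono' (hf.comp (hX.measurable_eval t)).aestronglyMeasurable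
    (.of_forall fun _ => hK _)

theorem HasIntegrableCost.integrable_compensatedProcess (hc : HasIntegrableCost Φ P X)
    (hΦ : Measurable Φ) (hX : IsMeasurableProcess X) {f g : E → ℝ} (hf : Measurable f)
    {K : ℝ} (hK : ∀ x, |f x| ≤ K) (hg : Measurable g) {C : ℝ} (hC : 0 ≤ C)
    (hgC : ∀ x, |g x| ≤ C * Φ x) (t : ℝ≥0) : Integrable (compensatedProcess f g X t) P :=
  (integrable_comp_of_abs_le hX hf hK t).sub (hc.integrable_pathIntegral_of_le hΦ hX hg hC hgC t)

theorem tendsto_setIntegral_compensatedProcess [MetricSpace E] [SecondCountableTopology E]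
    [BorelSpace E] (hc : HasIntegrableCost Φ P X) (hΦ : Measurable Φ) (hX : IsMeasurableProcess X)
    (hXc : IsContinuousInProbability P X) (f : E →ᵇ ℝ) {g : E → ℝ} (hg : Measurable g) {C : ℝ}
    (hC : 0 ≤ C) (hgC : ∀ x, |g x| ≤ C * Φ x) {u : ℕ → ℝ≥0} {t : ℝ≥0}
    (hu : Tendsto u atTop (𝓝 t)) (H : Set Ω) :
    Tendsto (fun j => ∫ ω in H, compensatedProcess f g X (u j) ω ∂P) atTop
      (𝓝 (∫ ω in H, compensatedProcess f g X t ω ∂P)) := by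
  have e (t : ℝ≥0) : ∫ ω in H, compensatedProcess f g X t ω ∂P
      = ∫ ω in H, f (X t ω) ∂P - ∫ ω in H, pathIntegral g X t ω ∂P :=
    integral_sub (integrable_comp_of_abs_le hX f.continuous.measurable
      (fun x => f.norm_coe_le_norm x) t).restrict
      (hc.integrable_pathIntegral_of_le hΦ hX hg hC hgC t).restrict
  simp only [e]
  exact (tendsto_setIntegral_of_tendstoInMeasure (fun j => hX.measurable_eval (u j))
    (fun ε hε => (hXc t ε hε).comp hu) f H).sub
    (tendsto_setIntegral_pathIntegral hC hc hΦ hX (fun _ => hg) (fun _ => hgC)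
      (fun _ => tendsto_const_nhds) hu H)

/-- Under bounded pointwise convergence both terms converge by dominated convergence, the time
integrals being dominated by a multiple of the integrable cost. Measurability and boundedness belong
to the set because membership must supply them for the approximating pairs. -/
theorem isBPClosed_setIntegral_eq (hc : HasIntegrableCost Φ P X) (hΦ : Measurable Φ)
    (hX : IsMeasurableProcess X) (s t : ℝ≥0) (H : Set Ω) :
    IsBPClosed {p : (E → ℝ) × (E → ℝ) | Measurable p.1 ∧ Measurable p.2 ∧
      (∃ K : ℝ, ∀ x, |p.1 x| ≤ K ∧ |p.2 x| ≤ K) ∧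
      ∫ ω in H, compensatedProcess p.1 (fun x => Φ x * p.2 x) X t ω ∂P
        = ∫ ω in H, compensatedProcess p.1 (fun x => Φ x * p.2 x) X s ω ∂P} := by
  rintro w p hw ⟨K, hK⟩ hlim
  have hp1 : Measurable p.1 := measurable_of_tendsto_metrizable (fun n => (hw n).1)
    (tendsto_pi_nhds.2 fun x => (hlim x).1)
  have hp2 : Measurable p.2 := measurable_of_tendsto_metrizable (fun n => (hw n).2.1)
    (tendsto_pi_nhds.2 fun x => (hlim x).2)
  have hpK : ∀ x, |p.1 x| ≤ K ∧ |p.2 x| ≤ K := fun x =>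
    ⟨le_of_tendsto' (hlim x).1.abs fun n => (hK n x).1,
      le_of_tendsto' (hlim x).2.abs fun n => (hK n x).2⟩
  refine ⟨hp1, hp2, ⟨K, hpK⟩, ?_⟩
  have hbd : ∀ (q : E → ℝ), (∀ x, |q x| ≤ K) → ∀ x, |Φ x * q x| ≤ |K| * Φ x := by
    intro q hq x
    rw [abs_mul, NNReal.abs_eq, mul_comm]
    exact mul_le_mul_of_nonneg_right ((hq x).trans (le_abs_self K)) (Φ x).2
  have hmeas : ∀ {q : E → ℝ}, Measurable q → Measurable fun x => Φ x * q x := fun hq =>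
    hΦ.coe_nnreal_real.mul hq
  have key (t : ℝ≥0) : Tendsto (fun n => ∫ ω in H,
        compensatedProcess (w n).1 (fun x => Φ x * (w n).2 x) X t ω ∂P) atTop
      (𝓝 (∫ ω in H, compensatedProcess p.1 (fun x => Φ x * p.2 x) X t ω ∂P)) := by
    have e {q : (E → ℝ) × (E → ℝ)} (h1 : Measurable q.1) (h2 : Measurable q.2)
        (hq : ∀ x, |q.1 x| ≤ K ∧ |q.2 x| ≤ K) :
        ∫ ω in H, compensatedProcess q.1 (fun x => Φ x * q.2 x) X t ω ∂P
        = ∫ ω in H, q.1 (X t ω) ∂P - ∫ ω in H, pathIntegral (fun x => Φ x * q.2 x) X t ω ∂P :=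
      integral_sub (integrable_comp_of_abs_le hX h1 (fun x => (hq x).1) t).restrict
        (hc.integrable_pathIntegral_of_le hΦ hX (hmeas h2) (abs_nonneg K)
          (hbd _ fun x => (hq x).2) t).restrict
    rw [e hp1 hp2 hpK]
    simp only [fun n => e (hw n).1 (hw n).2.1 (hK n)]
    refine Tendsto.sub ?_ (tendsto_setIntegral_pathIntegral (abs_nonneg K) hc hΦ hX
      (fun n => hmeas (hw n).2.1) (fun n => hbd _ fun x => (hK n x).2)
      (fun x => (hlim x).2.const_mul _) tendsto_const_nhds H)
    exact tendsto_integral_of_dominated_convergence (fun _ => K)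
      (fun n => ((hw n).1.comp (hX.measurable_eval t)).aestronglyMeasurable) (integrable_const K)
      (fun n => .of_forall fun ω => (hK n _).1) (.of_forall fun ω => (hlim _).1)
  exact tendsto_nhds_unique (key t) ((key s).congr fun n => (hw n).2.2.2.symm)

theorem setIntegral_preimage_eq_of_isSetAlgebra {Ω S : Type*} [MeasurableSpace Ω]
    [mS : MeasurableSpace S] {μ : Measure Ω} {u v : Ω → ℝ} (hu : Integrable u μ)
    (hv : Integrable v μ) {τ : Ω → S} (hτ : Measurable τ) {𝒜 : Set (Set S)}
    (h𝒜 : IsSetAlgebra 𝒜) (hgen : mS = MeasurableSpace.generateFrom 𝒜)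
    (h : ∀ B ∈ 𝒜, ∫ ω in τ ⁻¹' B, u ω ∂μ = ∫ ω in τ ⁻¹' B, v ω ∂μ) {B : Set S}
    (hB : MeasurableSet B) : ∫ ω in τ ⁻¹' B, u ω ∂μ = ∫ ω in τ ⁻¹' B, v ω ∂μ := by
  induction B, hB using MeasurableSpace.induction_on_inter hgen
    (fun _ hs _ ht _ => h𝒜.inter_mem hs ht) with
  | empty => simp
  | basic B hB => exact h B hB
  | compl B hB ih =>
    -- The whole space lies in the algebra, so the total integrals agree, as the complement step
    -- needs.
    have h1 := h _ h𝒜.univ_mem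
    simp only [Set.preimage_univ, setIntegral_univ] at h1
    rw [Set.preimage_compl, setIntegral_compl (hτ hB) hu, setIntegral_compl (hτ hB) hv, ih, h1]
  | iUnion f hd hf ih =>
    have hd' : Pairwise (Function.onFun Disjoint fun i => τ ⁻¹' f i) :=
      fun i j hij => (hd hij).preimage τ
    rw [Set.preimage_iUnion, integral_iUnion (fun i => hτ (hf i)) hd' hu.integrableOn,
      integral_iUnion (fun i => hτ (hf i)) hd' hv.integrableOn]
    exact tsum_congr ih

theorem martingale_compensatedProcess [MetricSpace E] [BorelSpace E]
    (hX : IsMeasurableProcess X) (f : E →ᵇ ℝ) {g : E → ℝ} (hg : Measurable g)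
    (hint : ∀ t, Integrable (compensatedProcess f g X t) P)
    (h : ∀ s t : ℝ≥0, s ≤ t → ∀ H, MeasurableSet[starFiltration X hX s] H →
      ∫ ω in H, compensatedProcess f g X t ω ∂P = ∫ ω in H, compensatedProcess f g X s ω ∂P) :
    Martingale (compensatedProcess f g X) (starFiltration X hX) P := by
  have had : StronglyAdapted (starFiltration X hX) (compensatedProcess f g X) := fun t =>
    ((f.continuous.measurable.comp (measurable_starFiltration_eval hX le_rfl)).sub
      (measurable_starFiltration_pathIntegral hX hg t)).stronglyMeasurable
  refine ⟨had, fun s t hst => (ae_eq_condExp_of_forall_setIntegral_eq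
    ((starFiltration X hX).le s) (hint t) (fun _ _ _ => (hint s).integrableOn)
    (fun H hH _ => (h s t hst H hH).symm) (had s).aestronglyMeasurable).symm⟩

end Compensated

/-! ### Good codes give solutions. -/

section Codes

theorem pathIntegral_extendPath_truncatePath {E : Type u} [MetricSpace E] [Nonempty E]
    (g : E → ℝ) (n : ℕ → ℕ) {t u : ℝ≥0} (h : t ≤ u) (ω : ℚ≥0 → E) : pathIntegral g (extendPath n) t (truncatePath u ω)
      = pathIntegral g (extendPath n) t ω := by
  rw [pathIntegral_eq_setIntegral, pathIntegral_eq_setIntegral]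
  refine setIntegral_congr_fun measurableSet_Ioc fun s hs => ?_
  have hs' : s.toNNReal ≤ u := (Real.toNNReal_le_iff_le_coe.2 hs.2).trans h
  simp only [extendPath_truncatePath n hs']

theorem comap_le_comap_of_comp_eq {S β : Type*} [MeasurableSpace S] [mβ : MeasurableSpace β]
    {F : S → β} (hF : Measurable F) {τ : S → S} (h : ∀ x, F (τ x) = F x) :
    MeasurableSpace.comap F mβ ≤ MeasurableSpace.comap τ inferInstance := by
  have e : F = F ∘ τ := funext fun x => (h x).symm
  rw [e, ← MeasurableSpace.comap_comp]
  exact MeasurableSpace.comap_mono hF.comap_le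

variable {E : Type u} [MetricSpace E] [MeasurableSpace E] [Nonempty E]

/-- Countably many conditions on a law `Q` on paths at rational times and a modulus `n`, which
together say that the extension of the paths to real times solves the martingale problem. -/
structure IsGoodCode (D : Set (E →ᵇ ℝ)) (A : D → E → ℝ) (Φ : E → ℝ≥0) (S : Set D)
    (𝒜 : Set (Set (ℚ≥0 → E))) (Q : Measure (ℚ≥0 → E)) (n : ℕ → ℕ) : Prop where
  modulus : HasModulus Q n
  cost : ∀ T : ℕ, ∫⁻ ω, ∫⁻ s in Set.Ioc (0 : ℝ) (T : ℝ),
    (Φ (extendPath n s.toNNReal ω) : ℝ≥0∞) ∂volume ∂Q < ∞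
  balance : ∀ f ∈ S, ∀ s r : ℚ≥0, s ≤ r → ∀ B ∈ 𝒜,
    ∫ ω in truncatePath s ⁻¹' B, compensatedProcess (f : E →ᵇ ℝ) (A f) (extendPath n) r ω ∂Q
      = ∫ ω in truncatePath s ⁻¹' B, compensatedProcess (f : E →ᵇ ℝ) (A f) (extendPath n) s ω ∂Q

theorem IsDominated.exists_nonneg {E : Type u} [MetricSpace E] {D : Set (E →ᵇ ℝ)}
    {A : D → E → ℝ} {Φ : E → ℝ≥0} (hA : IsDominated D A Φ) (f : D) :
    ∃ C : ℝ, 0 ≤ C ∧ ∀ x, |A f x| ≤ C * Φ x := by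
  obtain ⟨C, hC⟩ := hA f
  exact ⟨max C 0, le_max_right _ _, fun x =>
    (hC x).trans (mul_le_mul_of_nonneg_right (le_max_left _ _) (Φ x).2)⟩

variable {D : Set (E →ᵇ ℝ)} {A : D → E → ℝ} {Φ : E → ℝ≥0} {S : Set D}
  {𝒜 : Set (Set (ℚ≥0 → E))} {Q : Measure (ℚ≥0 → E)} {n : ℕ → ℕ}

theorem IsGoodCode.hasIntegrableCost (h : IsGoodCode D A Φ S 𝒜 Q n) :
    HasIntegrableCost Φ Q (extendPath n) := by
  intro T
  obtain ⟨m, hm⟩ := exists_nat_ge T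
  refine (lintegral_mono fun ω => ?_).trans_lt (h.cost m)
  exact lintegral_mono_set (Set.Ioc_subset_Ioc_right (by exact_mod_cast hm))

variable [CompleteSpace E] [SecondCountableTopology E] [BorelSpace E] [IsProbabilityMeasure Q]

/-- The values and time integrals of the extended path up to time s do not change when the rational
path is truncated at s. Past events are therefore preimages under `truncatePath s`. -/
theorem starFiltration_extendPath_le (n : ℕ → ℕ) (s : ℝ≥0) :
    starFiltration (extendPath (E := E) n) (isMeasurableProcess_extendPath n) s
      ≤ MeasurableSpace.comap (truncatePath s) inferInstance := by
  refine iSup₂_le fun v hv => sup_le ?_ (iSup_le fun h => ?_)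
  · exact comap_le_comap_of_comp_eq ((isMeasurableProcess_extendPath n).measurable_eval v)
      fun ω => extendPath_truncatePath n hv ω
  · exact comap_le_comap_of_comp_eq (measurable_pathIntegral h.continuous.measurable
      (isMeasurableProcess_extendPath n) v) fun ω => pathIntegral_extendPath_truncatePath _ n hv ω

/-- At rational times the identity extends from the algebra to the generated σ-field. Real times are
then approached from above: an event in the past of s is also in the past of every rational q ≥ s,
and continuity in probability passes the integrals to the limit. -/
theorem IsGoodCode.setIntegral_eq (h : IsGoodCode D A Φ S 𝒜 Q n) (h𝒜 : IsSetAlgebra 𝒜)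
    (hgen : MeasurableSpace.pi = MeasurableSpace.generateFrom 𝒜) (hA : ∀ f : D, Measurable (A f))
    (hΦ : Measurable Φ) (hA1 : IsDominated D A Φ) {f : D} (hf : f ∈ S) {s t : ℝ≥0} (hst : s ≤ t)
    {B : Set (ℚ≥0 → E)} (hB : MeasurableSet B) :
    ∫ ω in truncatePath s ⁻¹' B, compensatedProcess (f : E →ᵇ ℝ) (A f) (extendPath n) t ω ∂Q
      = ∫ ω in truncatePath s ⁻¹' B,
          compensatedProcess (f : E →ᵇ ℝ) (A f) (extendPath n) s ω ∂Q := by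
  obtain ⟨C, hC, hAC⟩ := hA1.exists_nonneg f
  have hY := isMeasurableProcess_extendPath (E := E) n
  have hc := h.hasIntegrableCost
  have hint := hc.integrable_compensatedProcess hΦ hY (f := (f : E →ᵇ ℝ))
    (f : E →ᵇ ℝ).continuous.measurable (fun x => (f : E →ᵇ ℝ).norm_coe_le_norm x) (hA f) hC hAC
  have hrat : ∀ q r : ℚ≥0, s ≤ q → q ≤ r →
      ∫ ω in truncatePath s ⁻¹' B, compensatedProcess (f : E →ᵇ ℝ) (A f) (extendPath n) r ω ∂Q
      = ∫ ω in truncatePath s ⁻¹' B,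
          compensatedProcess (f : E →ᵇ ℝ) (A f) (extendPath n) q ω ∂Q := by
    intro q r hsq hqr
    have e : (truncatePath s ⁻¹' B : Set (ℚ≥0 → E))
        = truncatePath q ⁻¹' (truncatePath s ⁻¹' B) := by
      ext ω
      simp [truncatePath_truncatePath hsq]
    rw [e]
    exact setIntegral_preimage_eq_of_isSetAlgebra (hint r) (hint q) (measurable_truncatePath _) h𝒜
      hgen (h.balance f hf q r hqr) (measurable_truncatePath s hB)
  have hseq : ∀ a : ℝ≥0, ∃ u : ℕ → ℚ≥0, (∀ j, a ≤ (u j : ℝ≥0)) ∧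
      Tendsto (fun j => (u j : ℝ≥0)) atTop (𝓝 a) := by
    intro a
    have h1 (j : ℕ) : ∃ q : ℚ≥0, a < q ∧ (q : ℝ≥0) < a + 1 / (j + 1) := by
      obtain ⟨q, hq, h1, h2⟩ := (NNReal.lt_iff_exists_rat_btwn a (a + 1 / (j + 1))).1
        (lt_add_of_pos_right a (by positivity))
      lift q to ℚ≥0 using hq
      have e : Real.toNNReal ((q : ℚ) : ℝ) = (q : ℝ≥0) := by
        ext
        simp only [Real.coe_toNNReal', Rat.cast_nnratCast]
        exact max_eq_left (NNRat.cast_nonneg q)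
      exact ⟨q, e ▸ h1, e ▸ h2⟩
    choose u hu1 hu2 using h1
    refine ⟨u, fun j => (hu1 j).le, tendsto_of_tendsto_of_tendsto_of_le_of_le tendsto_const_nhds
      ?_ (fun j => (hu1 j).le) (fun j => (hu2 j).le)⟩
    simpa using tendsto_const_nhds.add (tendsto_one_div_add_atTop_nhds_zero_nat (𝕜 := ℝ≥0))
  have hlim : ∀ {a : ℝ≥0} {u : ℕ → ℝ≥0}, Tendsto u atTop (𝓝 a) → _ := fun hu =>
    tendsto_setIntegral_compensatedProcess hc hΦ hY h.modulus.isContinuousInProbability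
      (f : E →ᵇ ℝ) (hA f) hC hAC hu (truncatePath s ⁻¹' B)
  obtain ⟨u, hu, hu'⟩ := hseq t
  obtain ⟨v, hv, hv'⟩ := hseq s
  refine tendsto_nhds_unique (hlim hu') ((hlim hv').congr fun j => ?_)
  -- The approximations of s and t may come in either order; only their both being at least s
  -- matters.
  rcases le_total (u j) (v j) with huv | huv
  · exact hrat _ _ (hst.trans (hu j)) huv
  · exact (hrat _ _ (hv j) huv).symm

theorem IsGoodCode.isSolution (h : IsGoodCode D A Φ S 𝒜 Q n) (h𝒜 : IsSetAlgebra 𝒜)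
    (hgen : MeasurableSpace.pi = MeasurableSpace.generateFrom 𝒜) (hA : ∀ f : D, Measurable (A f))
    (hΦ : Measurable Φ) (hA1 : IsDominated D A Φ)
    (hS : Set.range (scaledPair D A Φ) ⊆ bpClosure (scaledPair D A Φ '' S)) {x : E}
    (hx : Q {ω | ω 0 = x} = 1) : IsSolution D A Φ (Measure.dirac x) Q (extendPath n) := by
  have hY := isMeasurableProcess_extendPath (E := E) n
  have hc := h.hasIntegrableCost
  refine ⟨hY, ?_, hc, fun f => ?_⟩
  · have h0 : extendPath n 0 =ᵐ[Q] fun _ => x := by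
      have hm : MeasurableSet {ω : ℚ≥0 → E | ω 0 = x} :=
        measurableSet_eq_fun (measurable_pi_apply 0) measurable_const
      have h1 : ∀ᵐ ω ∂Q, ω 0 = x := (mem_ae_iff_prob_eq_one hm).2 hx
      have h2 := h.modulus.ae_eq 0
      rw [NNRat.cast_zero] at h2
      filter_upwards [h1, h2] with ω h1 h2
      rw [h2, h1]
    rw [Measure.map_congr h0, Measure.map_const, measure_univ, one_smul]
  -- Where Φ vanishes, domination makes Af vanish, so the convention for the inverse of zero loses
  -- nothing.
  · have hmul : ∀ f : D, (fun x => (Φ x : ℝ) * (scaledPair D A Φ f).2 x) = A f := by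
      intro f
      funext x
      obtain ⟨C, hC⟩ := hA1 f
      by_cases h0 : Φ x = 0
      · have := hC x
        simp only [h0, NNReal.coe_zero, mul_zero, abs_nonpos_iff] at this
        simp [h0, this]
      · exact mul_inv_cancel_left₀ (NNReal.coe_ne_zero.2 h0) _
    obtain ⟨C, hC, hAC⟩ := hA1.exists_nonneg f
    refine martingale_compensatedProcess hY (f : E →ᵇ ℝ) (hA f)
      (hc.integrable_compensatedProcess hΦ hY (f : E →ᵇ ℝ).continuous.measurable
        (fun x => (f : E →ᵇ ℝ).norm_coe_le_norm x) (hA f) hC hAC) fun s t hst H hH => ?_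
    obtain ⟨B, hB, rfl⟩ := starFiltration_extendPath_le n s H hH
    -- For this fixed past event, the pairs satisfying the identity form a bp-closed set. It remains
    -- to see that it contains the pairs from `S`.
    have hmem := hS ⟨f, rfl⟩ _ ⟨?_, isBPClosed_setIntegral_eq hc hΦ hY s t
      (truncatePath s ⁻¹' B)⟩
    · have := hmem.2.2.2
      rwa [hmul f] at this
    · rintro _ ⟨f, hf, rfl⟩
      obtain ⟨C, hC, hAC⟩ := hA1.exists_nonneg f
      refine ⟨(f : E →ᵇ ℝ).continuous.measurable,
        hΦ.coe_nnreal_real.inv.mul (hA f), ⟨max ‖(f : E →ᵇ ℝ)‖ C, fun x =>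
          ⟨((f : E →ᵇ ℝ).norm_coe_le_norm x).trans (le_max_left _ _), ?_⟩⟩, ?_⟩
      · refine le_trans ?_ (le_max_right _ _)
        simp only [scaledPair, abs_mul, abs_inv, NNReal.abs_eq]
        exact inv_mul_le_of_le_mul₀ (Φ x).2 hC ((hAC x).trans_eq (mul_comm _ _))
      · rw [hmul f]
        exact h.setIntegral_eq h𝒜 hgen hA hΦ hA1 hf hst hB

end Codes

end MartingaleProblem
namespace MartingaleProblem

/-! ### Solutions give good codes, and good codes form a Borel set. -/

theorem measurable_hasModulus_code {E : Type u} [MetricSpace E] [SecondCountableTopology E]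
    [MeasurableSpace E] [BorelSpace E] {κ : Kernel (ℚ → ℝ) (ℚ≥0 → E)} :
    Measurable fun c : (ℚ → ℝ) × (ℕ → ℕ) => HasModulus (κ c.1) c.2 := by
  have hn (k : ℕ) : Measurable fun c : (ℚ → ℝ) × (ℕ → ℕ) => c.2 k :=
    (measurable_pi_apply k).comp measurable_snd
  refine Measurable.and ?_ (.forall fun k => .forall fun q => .forall fun q' =>
    .imp measurable_const (.imp measurable_const (.imp ?_ ?_)))
  · have e : (fun c : (ℚ → ℝ) × (ℕ → ℕ) => StrictMono c.2)
        = fun c => ∀ k, c.2 k < c.2 (k + 1) := by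
      funext c
      exact propext ⟨fun h k => h k.lt_succ_self, strictMono_nat_of_lt_succ⟩
    rw [e]
    exact .forall fun k => (measurableSet_lt (hn k) (hn (k + 1))).mem
  · have h : Measurable fun c : (ℚ → ℝ) × (ℕ → ℕ) => 1 / ((c.2 k : ℝ) + 1) :=
      (measurable_from_top (f := fun m : ℕ => 1 / ((m : ℝ) + 1))).comp (hn k)
    exact measurableSet_setOfPred.1 (measurableSet_le measurable_const h)
  · have h : Measurable fun c : (ℚ → ℝ) × (ℕ → ℕ) =>
        κ c.1 {ω | (1 / 2 : ℝ) ^ k ≤ dist (ω q) (ω q')} :=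
      (κ.measurable_coe (measurableSet_le measurable_const
        ((measurable_pi_apply q).dist (measurable_pi_apply q')))).comp measurable_fst
    exact measurableSet_setOfPred.1 (measurableSet_le h measurable_const)

theorem measurable_starFiltration_truncatePath {E Ω : Type u} [MetricSpace E]
    [MeasurableSpace E] [BorelSpace E] [MeasurableSpace Ω] {X : ℝ≥0 → Ω → E}
    (hX : IsMeasurableProcess X) (s : ℝ≥0) :
    Measurable[starFiltration X hX s] fun ω => truncatePath s fun q => X q ω := by
  refine @measurable_pi_iff _ _ _ (starFiltration X hX s) _ _ |>.2 fun q => ?_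
  unfold truncatePath
  split_ifs with h
  · exact measurable_starFiltration_eval hX h
  · exact measurable_starFiltration_eval hX (by simp)

variable {E : Type u} [MetricSpace E] [CompleteSpace E] [SecondCountableTopology E]
  [MeasurableSpace E] [BorelSpace E]

section OfSolution

variable [Nonempty E] {Ω : Type u} [MeasurableSpace Ω] {P : Measure Ω} [IsProbabilityMeasure P]
  {X : ℝ≥0 → Ω → E} {n : ℕ → ℕ}

/-- By Fubini, a modification agrees with the process at almost every time on almost every path, so
the two have the same time integrals. -/
theorem ae_ae_extendPath_eq (hX : IsMeasurableProcess X)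
    (h : ∀ t, ∀ᵐ ω ∂P, extendPath n t (fun q => X q ω) = X t ω) :
    ∀ᵐ ω ∂P, ∀ᵐ s : ℝ, extendPath n s.toNNReal (fun q => X q ω) = X s.toNNReal ω := by
  have hm : MeasurableSet {p : ℝ × Ω |
      extendPath n p.1.toNNReal (fun q => X q p.2) = X p.1.toNNReal p.2} := by
    have h1 : Measurable fun p : ℝ × Ω => p.1.toNNReal :=
      measurable_real_toNNReal.comp measurable_fst
    exact measurableSet_eq_fun ((isMeasurableProcess_extendPath n).comp
      (h1.prodMk (hX.measurable_rationalPath.comp measurable_snd)))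
      (hX.comp (h1.prodMk measurable_snd))
  exact (Measure.ae_ae_comm (p := fun (s : ℝ) ω =>
    extendPath n s.toNNReal (fun q => X q ω) = X s.toNNReal ω) hm).1 (.of_forall fun s => h _)

theorem IsSolution.exists_isGoodCode {D : Set (E →ᵇ ℝ)} {A : D → E → ℝ} {Φ : E → ℝ≥0} {x : E}
    (hS : IsSolution D A Φ (Measure.dirac x) P X) (hXc : IsContinuousInProbability P X)
    (hA : ∀ f : D, Measurable (A f)) (hΦ : Measurable Φ) (S : Set D)
    {𝒜 : Set (Set (ℚ≥0 → E))} (h𝒜 : ∀ B ∈ 𝒜, MeasurableSet B) :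
    ∃ n, IsGoodCode D A Φ S 𝒜 (P.map fun ω (q : ℚ≥0) => X q ω) n ∧
      (P.map fun ω (q : ℚ≥0) => X q ω) {ω | ω 0 = x} = 1 := by
  obtain ⟨n, hn, hmod⟩ := hXc.exists_strictMono
  have hX := hS.measurable
  have hρ := hX.measurable_rationalPath
  have hY := isMeasurableProcess_extendPath (E := E) n
  have hae := ae_extendPath_eq hmod
  have haes := ae_ae_extendPath_eq hX hae
  refine ⟨n, ⟨⟨hn, fun k q q' hq hq' hqq' => ?_⟩, fun T => ?_, fun f _ s r hsr B hB => ?_⟩, ?_⟩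
  · rw [Measure.map_apply hρ (measurableSet_le measurable_const
      ((measurable_pi_apply q).dist (measurable_pi_apply q')))]
    exact hmod k q q' hq hq' hqq'
  · rw [lintegral_map (measurable_lintegral_path hΦ hY T) hρ]
    refine lt_of_eq_of_lt (lintegral_congr_ae ?_) (hS.integrable T)
    filter_upwards [haes] with ω hω
    refine lintegral_congr_ae (ae_restrict_of_ae ?_)
    filter_upwards [hω] with s hs
    rw [hs]
  · have hBm : MeasurableSet (truncatePath s ⁻¹' B) := measurable_truncatePath _ (h𝒜 B hB)
    have key (t : ℝ≥0) : ∫ ω in truncatePath s ⁻¹' B,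
          compensatedProcess (f : E →ᵇ ℝ) (A f) (extendPath n) t ω ∂(P.map fun ω (q : ℚ≥0) => X q ω)
        = ∫ ω in (fun ω => truncatePath s fun q => X q ω) ⁻¹' B,
          compensatedProcess (f : E →ᵇ ℝ) (A f) X t ω ∂P := by
      rw [setIntegral_map hBm (measurable_compensatedProcess hY
        (f : E →ᵇ ℝ).continuous.measurable (hA f) t).aestronglyMeasurable hρ.aemeasurable]
      refine setIntegral_congr_ae (hρ hBm) ?_
      filter_upwards [hae t, haes] with ω h1 h2 _
      unfold compensatedProcess
      rw [h1, pathIntegral_eq_setIntegral, pathIntegral_eq_setIntegral]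
      congr 1
      refine integral_congr_ae (ae_restrict_of_ae ?_)
      filter_upwards [h2] with s hs
      rw [hs]
    -- On the original space the event depends on the path up to time s only, so the martingale
    -- property of `X` applies to it.
    rw [key, key]
    exact ((hS.martingale f).setIntegral_eq (NNRat.cast_le.2 hsr)
      (measurable_starFiltration_truncatePath hX s (h𝒜 B hB))).symm
  · have hm : MeasurableSet {ω : ℚ≥0 → E | ω 0 = x} :=
      measurableSet_eq_fun (measurable_pi_apply 0) measurable_const
    rw [Measure.map_apply hρ hm]
    have h0 := congrArg (fun μ : Measure E => μ {x}) hS.initial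
    simp only [Measure.map_apply (hX.measurable_eval 0) (measurableSet_singleton x),
      Measure.dirac_apply_of_mem (Set.mem_singleton x)] at h0
    rw [← h0]
    congr 1
    ext ω
    simp

end OfSolution

section Measurability

variable [Nonempty E] {κ : Kernel (ℚ → ℝ) (ℚ≥0 → E)} [IsMarkovKernel κ]

theorem measurable_extendPath_code : Measurable fun p : (((ℚ → ℝ) × (ℕ → ℕ)) × (ℚ≥0 → E)) × ℝ =>
    extendPath p.1.1.2 p.2.toNNReal p.1.2 :=
  measurable_extendPath.comp (((measurable_fst.fst.snd).prodMk
    (measurable_real_toNNReal.comp measurable_snd)).prodMk measurable_fst.snd)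

theorem measurable_compensatedProcess_code {f g : E → ℝ} (hf : Measurable f) (hg : Measurable g)
    (t : ℝ≥0) : Measurable fun p : ((ℚ → ℝ) × (ℕ → ℕ)) × (ℚ≥0 → E) =>
      compensatedProcess f g (extendPath p.1.2) t p.2 := by
  simp only [compensatedProcess, pathIntegral_eq_setIntegral]
  refine (hf.comp (measurable_extendPath.comp (((measurable_fst.snd).prodMk
    measurable_const).prodMk measurable_snd))).sub ?_
  exact ((hg.comp measurable_extendPath_code).stronglyMeasurable.integral_prod_right'
    (ν := (volume : Measure ℝ).restrict (Set.Ioc 0 (t : ℝ)))).measurable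

theorem measurable_setIntegral_compensatedProcess_code {f g : E → ℝ} (hf : Measurable f)
    (hg : Measurable g) (t : ℝ≥0) {H : Set (ℚ≥0 → E)} (hH : MeasurableSet H) :
    Measurable fun c : (ℚ → ℝ) × (ℕ → ℕ) =>
      ∫ ω in H, compensatedProcess f g (extendPath c.2) t ω ∂κ c.1 := by
  simp only [← integral_indicator hH]
  have h1 : Measurable (Function.uncurry fun (c : (ℚ → ℝ) × (ℕ → ℕ)) (ω : ℚ≥0 → E) =>
      H.indicator (compensatedProcess f g (extendPath c.2) t) ω) :=
    (measurable_compensatedProcess_code hf hg t).indicator (measurable_snd hH)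
  exact (StronglyMeasurable.integral_kernel_prod_right
    (κ := κ.comap Prod.fst measurable_fst) h1.stronglyMeasurable).measurable

theorem measurableSet_isGoodCode {D : Set (E →ᵇ ℝ)} {A : D → E → ℝ} {Φ : E → ℝ≥0}
    (hA : ∀ f : D, Measurable (A f)) (hΦ : Measurable Φ) {S : Set D} (hS : S.Countable)
    {𝒜 : Set (Set (ℚ≥0 → E))} (h𝒜c : 𝒜.Countable) (h𝒜 : ∀ B ∈ 𝒜, MeasurableSet B) :
    MeasurableSet {c : (ℚ → ℝ) × (ℕ → ℕ) | IsGoodCode D A Φ S 𝒜 (κ c.1) c.2} := by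
  have := hS.to_subtype
  have := h𝒜c.to_subtype
  have e : {c : (ℚ → ℝ) × (ℕ → ℕ) | IsGoodCode D A Φ S 𝒜 (κ c.1) c.2}
      = {c | HasModulus (κ c.1) c.2} ∩ (⋂ T : ℕ, {c | ∫⁻ ω, ∫⁻ s in Set.Ioc (0 : ℝ) (T : ℝ),
        (Φ (extendPath c.2 s.toNNReal ω) : ℝ≥0∞) ∂volume ∂κ c.1 < ∞}) ∩
      ⋂ (f : S) (s : ℚ≥0) (r : ℚ≥0) (_ : s ≤ r) (B : 𝒜),
        {c | ∫ ω in truncatePath s ⁻¹' (B : Set (ℚ≥0 → E)),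
            compensatedProcess (f : E →ᵇ ℝ) (A f) (extendPath c.2) r ω ∂κ c.1
          = ∫ ω in truncatePath s ⁻¹' (B : Set (ℚ≥0 → E)),
            compensatedProcess (f : E →ᵇ ℝ) (A f) (extendPath c.2) s ω ∂κ c.1} := by
    ext c
    simp only [Set.mem_inter_iff, Set.mem_iInter, Set.mem_ofPred_eq]
    exact ⟨fun h => ⟨⟨h.modulus, h.cost⟩, fun f s r hsr B => h.balance f f.2 s r hsr B B.2⟩,
      fun h => ⟨h.1.1, h.1.2, fun f hf s r hsr B hB => h.2 ⟨f, hf⟩ s r hsr ⟨B, hB⟩⟩⟩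
  rw [e]
  refine (measurable_hasModulus_code.setOf.inter (.iInter fun T => ?_)).inter
    (.iInter fun f => .iInter fun s => .iInter fun r => .iInter fun _ => .iInter fun B => ?_)
  · refine measurableSet_lt (Measurable.lintegral_kernel_prod_right
      (κ := κ.comap Prod.fst measurable_fst) (f := fun c ω => ∫⁻ s in Set.Ioc (0 : ℝ) (T : ℝ),
        (Φ (extendPath c.2 s.toNNReal ω) : ℝ≥0∞)) ?_) measurable_const
    exact (hΦ.comp measurable_extendPath_code).coe_nnreal_ennreal.lintegral_prod_right'
  · exact measurableSet_eq_fun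
      (measurable_setIntegral_compensatedProcess_code (f : E →ᵇ ℝ).continuous.measurable (hA f) _
        (measurable_truncatePath _ (h𝒜 B B.2)))
      (measurable_setIntegral_compensatedProcess_code (f : E →ᵇ ℝ).continuous.measurable (hA f) _
        (measurable_truncatePath _ (h𝒜 B B.2)))

end Measurability

/-! ### The Suslin argument. -/

theorem exists_countable_isSetAlgebra_generateFrom (S : Type*) [m : MeasurableSpace S]
    [MeasurableSpace.CountablyGenerated S] :
    ∃ 𝒜 : Set (Set S), 𝒜.Countable ∧ IsSetAlgebra 𝒜 ∧ m = MeasurableSpace.generateFrom 𝒜 := by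
  refine ⟨generateSetAlgebra (MeasurableSpace.countableGeneratingSet S),
    countable_generateSetAlgebra (MeasurableSpace.countable_countableGeneratingSet),
    isSetAlgebra_generateSetAlgebra, ?_⟩
  rw [generateFrom_generateSetAlgebra_eq, MeasurableSpace.generateFrom_countableGeneratingSet]

theorem measurable_fdd_of_isWellPosed {D : Set (E →ᵇ ℝ)} {A : D → E → ℝ}
    (hA : ∀ f : D, Measurable (A f)) {Φ : E → ℝ≥0} (hΦ : Measurable Φ)
    (hA1 : IsDominated D A Φ) (hA2 : IsBPSeparable D A Φ) (hA3 : IsWellPosed D A Φ)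
    {Ω : E → Type u} [∀ x, MeasurableSpace (Ω x)] {P : ∀ x, Measure (Ω x)}
    [∀ x, IsProbabilityMeasure (P x)] {X : ∀ x, ℝ≥0 → Ω x → E}
    (hX : ∀ x, IsSolution D A Φ (Measure.dirac x) (P x) (X x))
    (hXc : ∀ x, IsContinuousInProbability (P x) (X x)) {m : ℕ} (t : Fin m → ℝ≥0)
    {B : Set (Fin m → E)} (hB : MeasurableSet B) :
    Measurable fun x => fdd (P x) (X x) t B := by
  -- `extendPath` needs a point of E as the default value of a limit that fails to exist.
  rcases isEmpty_or_nonempty E with hE | hE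
  · exact measurable_of_empty _
  obtain ⟨S, hSc, hS⟩ := hA2
  obtain ⟨𝒜, h𝒜c, h𝒜, hgen⟩ := exists_countable_isSetAlgebra_generateFrom (ℚ≥0 → E)
  have h𝒜m : ∀ B ∈ 𝒜, MeasurableSet B := fun B hB => hgen ▸ .basic B hB
  obtain ⟨κ, hκ, hκs⟩ := exists_kernel_eq_of_isProbabilityMeasure (ℚ≥0 → E)
  let R : Set (E × ((ℚ → ℝ) × (ℕ → ℕ))) :=
    {p | IsGoodCode D A Φ S 𝒜 (κ p.2.1) p.2.2 ∧ κ p.2.1 {ω | ω 0 = p.1} = 1}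
  have hR : MeasurableSet R := by
    refine (measurable_snd (measurableSet_isGoodCode hA hΦ hSc h𝒜c h𝒜m)).inter ?_
    have hm : MeasurableSet {p : (E × ((ℚ → ℝ) × (ℕ → ℕ))) × (ℚ≥0 → E) | p.2 0 = p.1.1} :=
      measurableSet_eq_fun ((measurable_pi_apply 0).comp measurable_snd) measurable_fst.fst
    exact measurableSet_eq_fun (Kernel.measurable_kernel_prodMk_left
      (κ := κ.comap (fun p : E × ((ℚ → ℝ) × (ℕ → ℕ)) => p.2.1) measurable_snd.fst) hm)
      measurable_const
  have hfdd : Measurable fun c : (ℚ → ℝ) × (ℕ → ℕ) => fdd (κ c.1) (extendPath c.2) t B := by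
    have hm : Measurable fun p : ((ℚ → ℝ) × (ℕ → ℕ)) × (ℚ≥0 → E) =>
        fun i => extendPath p.1.2 (t i) p.2 := measurable_pi_iff.2 fun i =>
      measurable_extendPath.comp (((measurable_fst.snd).prodMk measurable_const).prodMk
        measurable_snd)
    have e (c : (ℚ → ℝ) × (ℕ → ℕ)) : fdd (κ c.1) (extendPath c.2) t B
        = κ c.1 {ω | (fun i => extendPath c.2 (t i) ω) ∈ B} :=
      Measure.map_apply (hm.comp (measurable_const.prodMk measurable_id)) hB
    simp only [e]
    exact Kernel.measurable_kernel_prodMk_left (κ := κ.comap Prod.fst measurable_fst) (hm hB)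
  refine measurable_of_measurableSet_relation hR hfdd (fun x => ?_) fun x c hc => ?_
  · obtain ⟨n, hn, hx⟩ := (hX x).exists_isGoodCode (hXc x) hA hΦ S h𝒜m
    obtain ⟨z, hz⟩ := hκs _ (Measure.isProbabilityMeasure_map (μ := P x)
      (hX x).measurable.measurable_rationalPath.aemeasurable)
    exact ⟨(z, n), by simpa only [R, Set.mem_ofPred_eq, hz] using ⟨hn, hx⟩⟩
  · have hsol := hc.1.isSolution h𝒜 hgen hA hΦ hA1 hS hc.2
    -- Uniqueness compares the given solution with the one built on the path space from the code.
    rw [(hA3 x).2 (Ω x) (ℚ≥0 → E) (P x) (κ c.1) (X x) (extendPath c.2) (hX x) (hXc x) hsol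
      hc.1.modulus.isContinuousInProbability m t]

end MartingaleProblem
namespace MartingaleProblem

/-! ### Finite-dimensional distributions as continuous maps of the times. -/

section FiniteDimensional

variable {E Ω : Type u} [MetricSpace E] [MeasurableSpace Ω] {P : Measure Ω} {X : ℝ≥0 → Ω → E}

theorem IsContinuousInProbability.tendstoInMeasure_pi (hXc : IsContinuousInProbability P X)
    {m : ℕ} (t : Fin m → ℝ≥0) :
    TendstoInMeasure P (fun (s : Fin m → ℝ≥0) ω i => X (s i) ω) (𝓝 t) fun ω i => X (t i) ω := by
  intro ε hε
  have h1 : Tendsto (fun s : Fin m → ℝ≥0 =>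
      ∑ i, P {ω | ε ≤ edist (X (s i) ω) (X (t i) ω)}) (𝓝 t) (𝓝 (∑ _i : Fin m, 0)) :=
    tendsto_finsetSum _ fun i _ => (hXc (t i) ε hε).comp ((continuous_apply i).tendsto t)
  rw [Finset.sum_const_zero] at h1
  refine tendsto_of_tendsto_of_tendsto_of_le_of_le tendsto_const_nhds h1 (fun _ => zero_le)
    fun s => (measure_mono fun ω hω => ?_).trans (measure_iUnion_fintype_le P _)
  have hω' : ε ≤ edist (fun i => X (s i) ω) fun i => X (t i) ω := hω
  rw [edist_pi_def] at hω'
  obtain ⟨i, -, hi⟩ := (Finset.le_sup_iff hε).1 hω'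
  exact Set.mem_iUnion.2 ⟨i, hi⟩

theorem isProbabilityMeasure_fdd {E Ω : Type u} [MeasurableSpace E] [MeasurableSpace Ω]
    {P : Measure Ω} [IsProbabilityMeasure P] {X : ℝ≥0 → Ω → E}
    (hX : IsMeasurableProcess X) {m : ℕ} (t : Fin m → ℝ≥0) :
    IsProbabilityMeasure (fdd P X t) :=
  Measure.isProbabilityMeasure_map
    (measurable_pi_iff.2 fun i => hX.measurable_eval (t i)).aemeasurable

variable [SecondCountableTopology E] [MeasurableSpace E] [BorelSpace E] [IsProbabilityMeasure P]

/-- The finite-dimensional distributions of a measurable process that is continuous in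
probability, as a family of continuous maps. -/
noncomputable def fddMap (hX : IsMeasurableProcess X) (hXc : IsContinuousInProbability P X) :
    FddSpace E := fun _ =>
  { toFun := fun t => ⟨fdd P X t, isProbabilityMeasure_fdd hX t⟩
    continuous_toFun := continuous_iff_continuousAt.2 fun t =>
      ((hXc.tendstoInMeasure_pi t).tendstoInDistribution fun s =>
        (measurable_pi_iff.2 fun i => hX.measurable_eval (s i)).aemeasurable).tendsto }

/-- The factors are second countable and there are countably many, so the Borel field of the product
is the product of the Borel fields; in each factor evaluations suffice. -/
theorem measurable_borel_fddSpace {α : Type*} [MeasurableSpace α] {μ : α → FddSpace E}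
    (h : ∀ (m : ℕ) (t : Fin m → ℝ≥0),
      Measurable[_, borel (ProbabilityMeasure (Fin m → E))] fun a => μ a m t) :
    Measurable[_, borel (FddSpace E)] μ := by
  let _ (m : ℕ) : MeasurableSpace C(Fin m → ℝ≥0, ProbabilityMeasure (Fin m → E)) := borel _
  have _ (m : ℕ) : BorelSpace C(Fin m → ℝ≥0, ProbabilityMeasure (Fin m → E)) := ⟨rfl⟩
  rw [← BorelSpace.measurable_eq (α := FddSpace E)]
  exact measurable_pi_iff.2 fun m => measurable_borel_continuousMap (h m)

end FiniteDimensional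

end MartingaleProblem
theorem theorem3p2 {E : Type u} [MetricSpace E] [CompleteSpace E] [SecondCountableTopology E]
    [MeasurableSpace E] [BorelSpace E]
    (D : Set (E →ᵇ ℝ)) (A : D → E → ℝ) (hA : ∀ f : D, Measurable (A f))
    (Φ : E → ℝ≥0) (hΦ : Measurable Φ)
    (hA1 : MartingaleProblem.IsDominated D A Φ)
    (hA2 : MartingaleProblem.IsBPSeparable D A Φ)
    (hA3 : MartingaleProblem.IsWellPosed D A Φ)
    (Ω : E → Type u) [∀ x, MeasurableSpace (Ω x)]
    (P : ∀ x, Measure (Ω x)) [∀ x, IsProbabilityMeasure (P x)]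
    (X : ∀ x, ℝ≥0 → Ω x → E)
    (hX : ∀ x, MartingaleProblem.IsSolution D A Φ (Measure.dirac x) (P x) (X x))
    (hXc : ∀ x, MartingaleProblem.IsContinuousInProbability (P x) (X x)) :
    (∀ (t : ℝ≥0) (B : Set E), MeasurableSet B →
      Measurable fun x : E => P x {ω | X x t ω ∈ B}) ∧
    ∃ μ : E → MartingaleProblem.FddSpace E,
      (∀ (x : E) (m : ℕ) (t : Fin m → ℝ≥0),
        (μ x m t : Measure (Fin m → E)) = MartingaleProblem.fdd (P x) (X x) t) ∧
      Measurable[_, borel (MartingaleProblem.FddSpace E)] μ ∧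
      ∀ (m : ℕ) (t : Fin m → ℝ≥0),
        Measurable[_, borel (ProbabilityMeasure (Fin m → E))] fun x : E => μ x m t := by
  have hfdd {m : ℕ} (t : Fin m → ℝ≥0) {B : Set (Fin m → E)} (hB : MeasurableSet B) :
      Measurable fun x => MartingaleProblem.fdd (P x) (X x) t B :=
    MartingaleProblem.measurable_fdd_of_isWellPosed hA hΦ hA1 hA2 hA3 hX hXc t hB
  have hμ (m : ℕ) (t : Fin m → ℝ≥0) :
      Measurable[_, borel (ProbabilityMeasure (Fin m → E))] fun x : E =>
        MartingaleProblem.fddMap (hX x).measurable (hXc x) m t :=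
    MartingaleProblem.measurable_borel_probabilityMeasure fun B hB => hfdd t hB
  refine ⟨fun t B hB => ?_, fun x => MartingaleProblem.fddMap (hX x).measurable (hXc x),
    fun x m t => rfl, MartingaleProblem.measurable_borel_fddSpace hμ, hμ⟩
  -- The transition probability is the finite-dimensional distribution for a single time.
  have hB' : MeasurableSet {v : Fin 1 → E | v 0 ∈ B} := measurable_pi_apply 0 hB
  have e (x : E) : P x {ω | X x t ω ∈ B}
      = MartingaleProblem.fdd (P x) (X x) (fun _ : Fin 1 => t) {v | v 0 ∈ B} :=
    (Measure.map_apply (measurable_pi_iff.2 fun _ => (hX x).measurable.measurable_eval t)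
      hB').symm
  simpa only [e] using hfdd (fun _ : Fin 1 => t) hB'
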